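/- Let $n\ge 1$, $\tau>0$ and $m\in\mathbb R$ with $m<\tau$, and let $\langle\xi\rangle=(1+|\xi|^2)^{1/2}$. For $k=\lfloor\tau\rfloor$, let $C^\tau(\mathbb R^{2n})$ be the space of $C^k$ functions whose derivatives up to order $k$ are bounded and, if $\tau\notin\mathbb N$, whose derivatives of order $k$ are uniformly Hölder continuous with exponent $\tau-k$, with its usual norm. Let $a\in C^\tau S^m_{1,0}(\mathbb R^{2n}\times\mathbb R^n)$, i.e. $a=a(x,y,\xi)\colon\mathbb R^n\times\mathbb R^n\times\mathbb R^n\to\mathbb C$ is continuous, smooth in $\xi$, and for every multi-index $\gamma$ there is $C_\gamma$ with $$\|\partial_\xi^\gamma a(\cdot,\cdot,\xi)\|_{C^\tau(\mathbb R^{2n})}\le C_\gamma\langle\xi\rangle^{m-|\gamma|}\quad\text{for all }\xi\in\mathbb R^n.$$ Suppose that $$\partial_x^\alpha\partial_y^\beta a(x,y,\xi)\big|_{y=x}=0\quad\text{for all }x,\xi\in\mathbb R^n\text{ and all }\alpha,\beta\text{ with }|\alpha|+|\beta|<\tau .$$ Let $1<q<\infty$ and $0\le s<\min(\tau-m,\tau)$.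 Then for every $u\in\mathcal S(\mathbb R^n)$ and $x\in\mathbb R^n$ the oscillatory integral $$\mathrm{op}(a)u(x)=\lim_{\varepsilon\to0^+}(2\pi)^{-n}\int_{\mathbb R^{2n}}\chi(\varepsilon y,\varepsilon\xi)\,e^{i(x-y)\cdot\xi}\,a(x,y,\xi)\,u(y)\,dy\,d\xi$$ exists and is the same for every $\chi\in\mathcal S(\mathbb R^{2n})$ with $\chi(0,0)=1$; for every $u\in\mathcal S(\mathbb R^n)$ the function $\mathrm{op}(a)u$ lies in $L_q(\mathbb R^n)$; and $\mathrm{op}(a)$ extends from $\mathcal S(\mathbb R^n)$ to a bounded linear operator $$\mathrm{op}(a)\colon L_q(\mathbb R^n)\to H^s_q(\mathbb R^n),$$ where $H^s_q(\mathbb R^n)=\{f\in\mathcal S'(\mathbb R^n) : \mathcal F^{-1}(\langle\xi\rangle^s\hat f)\in L_q(\mathbb R^n)\}$ is the Bessel potential space, with norm $\|\mathcal F^{-1}(\langle\xi\rangle^s\hat f)\|_{L_q}$. -/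

import Mathlib

open MeasureTheory Filter Topology
open scoped SchwartzMap ENNReal ContDiff

noncomputable section

/-- Euclidean space `ℝⁿ`. -/
abbrev Rn (n : ℕ) : Type := EuclideanSpace ℝ (Fin n)

/-- `f ∈ C^τ(V; F)` with all the quantities that make up its `C^τ`-norm bounded by `C`.
With `k = ⌊τ⌋`: `f` is `k` times continuously differentiable, its derivatives up to order `k` are
bounded, and, if `τ` is not an integer, the derivative of order `k` is Hölder continuous with
exponent `τ - k`. For an integer `τ` this is the space `C^τ_b`. The `j`-th total derivative
collects the partial derivatives `∂^α f` with `|α| = j`. -/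
structure HasHolderBound {V F : Type*} [NormedAddCommGroup V] [NormedSpace ℝ V]
    [NormedAddCommGroup F] [NormedSpace ℝ F] (τ C : ℝ) (f : V → F) : Prop where
  contDiff : ContDiff ℝ (⌊τ⌋₊ : ℕ) f
  bound : ∀ j : ℕ, j ≤ ⌊τ⌋₊ → ∀ x : V, ‖iteratedFDeriv ℝ j f x‖ ≤ C
  holder : (⌊τ⌋₊ : ℝ) < τ → ∀ x y : V,
    ‖iteratedFDeriv ℝ ⌊τ⌋₊ f x - iteratedFDeriv ℝ ⌊τ⌋₊ f y‖ ≤ C * ‖x - y‖ ^ (τ - (⌊τ⌋₊ : ℝ))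

/-- The symbol class `C^τ S^m_{1,0}(V × ℝⁿ)`: `p` is continuous, smooth in `ξ`, and for every `j`
the derivatives of order `j` in `ξ` have `C^τ(V)`-norm at most `C_j ⟨ξ⟩^{m - j}`,
where `⟨ξ⟩ = (1 + |ξ|²)^{1/2}`. -/
structure IsHolderSymbol {V : Type*} [NormedAddCommGroup V] [NormedSpace ℝ V] {n : ℕ}
    (τ m : ℝ) (p : V → Rn n → ℂ) : Prop where
  continuous : Continuous (fun z : V × Rn n => p z.1 z.2)
  smooth : ∀ X : V, ContDiff ℝ ∞ (p X)
  bound : ∀ j : ℕ, ∃ C : ℝ, ∀ ξ : Rn n,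
    HasHolderBound τ (C * (1 + ‖ξ‖ ^ 2) ^ ((m - j) / 2))
      (fun X : V => iteratedFDeriv ℝ j (p X) ξ)

/-- The regularized integral
`(2π)⁻ⁿ ∫∫ χ(εy, εξ) e^{i(x-y)·ξ} a(x,y,ξ) u(y) dy dξ`. -/
def oscIntegralReg {n : ℕ} (a : Rn n × Rn n → Rn n → ℂ) (χ : 𝓢(Rn n × Rn n, ℂ))
    (u : 𝓢(Rn n, ℂ)) (x : Rn n) (ε : ℝ) : ℂ :=
  ((2 * (Real.pi : ℂ)) ^ n)⁻¹ * ∫ z : Rn n × Rn n,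
    χ (ε • z.1, ε • z.2) * Complex.exp (Complex.I * ((inner ℝ (x - z.1) z.2 : ℝ) : ℂ))
      * a (x, z.1) z.2 * u z.1

/-- `op(a)u(x)` exists as an oscillatory integral and equals `w`: the regularized integrals tend
to `w` as `ε → 0⁺`, for every cut-off `χ ∈ 𝓢(ℝ²ⁿ)` with `χ(0,0) = 1`. -/
def HasOscIntegral {n : ℕ} (a : Rn n × Rn n → Rn n → ℂ) (u : 𝓢(Rn n, ℂ)) (x : Rn n) (w : ℂ) :
    Prop :=
  ∀ χ : 𝓢(Rn n × Rn n, ℂ), χ (0, 0) = 1 →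
    Tendsto (fun ε : ℝ => oscIntegralReg a χ u x ε) (𝓝[>] 0) (𝓝 w)

/-- The tempered distribution `f` lies in the Bessel potential space `H^s_q(ℝⁿ)`, with norm at
most `C`; the norm is the `L_q`-norm of the Bessel potential of order `s` applied to `f`. -/
def HasSobolevBound {n : ℕ} (s : ℝ) (q : ℝ≥0∞) [Fact (1 ≤ q)] (C : ℝ) (f : 𝓢'(Rn n, ℂ)) : Prop :=
  ∃ g : Lp ℂ q (volume : Measure (Rn n)),
    TemperedDistribution.besselPotential (Rn n) ℂ s f = g ∧ ‖g‖ ≤ C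

theorem HasSobolevBound.memSobolev {n : ℕ} {s : ℝ} {q : ℝ≥0∞} [Fact (1 ≤ q)] {C : ℝ}
    {f : 𝓢'(Rn n, ℂ)} (h : HasSobolevBound s q C f) : TemperedDistribution.MemSobolev s q f :=
  h.imp fun _ hg => hg.1

end

open scoped FourierTransform

/-! The strict inequalities leave room to work with absolutely convergent sums of kernels, so that
Young's inequality is the only tool needed on `L_q`.

Cut the frequency `ξ` into dyadic shells `|ξ| ∼ 2^j`, with kernels `k_j(x, y)`. Integration by parts
in `ξ` gives `|k_j| ≤ K 2^{j(n+m)} (1 + 2^j|x-y|)^{-M}` for every `M`. By Taylor's formula the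
vanishing on the diagonal gives `|a| ≤ A |x-y|^τ ⟨ξ⟩^m`, hence `|k_j| ≤ K 2^{j(n+m)} |x-y|^τ`. A
geometric mean of the two (`mul_pow_le_of_interpolate`) yields, for any `τ' < τ`, a bound by
`2^{j(m-τ')}` times an `L¹`-normalized bump of width `2^{-j}` (`exists_norm_dyadicKernel_le`). If `m
< τ'`, these `L¹`-norms are summable.

For the Sobolev bound, decompose `⟨D⟩^s` dyadically as well and estimate the kernel of its `l`-th
piece composed with `k_j`. For `l ≤ j` the `L¹`-norm `2^{ls}` of the Bessel piece is multiplied by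
the gain `2^{j(m-τ')}`. For `j < l` the Bessel piece annihilates polynomials times `e^{i x·ξ}`, so
it only sees the Taylor remainder of `a` in `x`; interpolating again gives `2^{l(s-τ')} 2^{jm}`
(`exists_norm_composedKernel_le_of_lt`). After raising the order to `max m 0`, both are summable
over `(j, l)` as soon as `s + max m 0 < τ' < τ`, and `s < min (τ - m) τ` is exactly what permits
such a `τ'`.

Two identifications remain. The composed kernels really represent the Bessel potential of the
operator: this is checked by pairing with Schwartz functions
(`integral_mul_kernelOp_composedKernel`). The kernel sum really is the oscillatory integral: the
regularized symbols `χ(εy, εξ) a` obey the same kernel bounds uniformly in `ε ≤ 1`, so the limit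
passes through the sum over `j` (`hasOscIntegral_kernelOp_dyadicKernel`). -/

/-- `p` is a smooth symbol of order `m` on `ℝⁿ` with constants `C`:
`‖D^i p(ξ)‖ ≤ C i ⟨ξ⟩^{m - i}`. -/
structure SymbolBound {n : ℕ} (m : ℝ) (C : ℕ → ℝ) (p : Rn n → ℂ) : Prop where
  contDiff : ContDiff ℝ ∞ p
  bound : ∀ (i : ℕ) (ξ : Rn n),
    ‖iteratedFDeriv ℝ i p ξ‖ ≤ C i * (1 + ‖ξ‖ ^ 2) ^ ((m - i) / 2)

/-! ### Calculus of smooth symbols: products, differences, dilates, powers of `⟨ξ⟩`. -/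

namespace SymbolBound

variable {n : ℕ} {m m' : ℝ} {C C' : ℕ → ℝ} {p p' : Rn n → ℂ}

theorem nonneg (h : SymbolBound m C p) (i : ℕ) : 0 ≤ C i := by
  have := (norm_nonneg _).trans (h.bound i 0)
  simpa using this

theorem norm_le (h : SymbolBound m C p) (ξ : Rn n) : ‖p ξ‖ ≤ C 0 * (1 + ‖ξ‖ ^ 2) ^ (m / 2) := by
  simpa using h.bound 0 ξ

theorem mul (h : SymbolBound m C p) (h' : SymbolBound m' C' p') :
    SymbolBound (m + m')
      (fun i => ∑ k ∈ Finset.range (i + 1), (i.choose k : ℝ) * C k * C' (i - k))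
      (fun ξ => p ξ * p' ξ) := by
  refine ⟨h.contDiff.mul h'.contDiff, fun i ξ => ?_⟩
  refine (norm_iteratedFDeriv_mul_le h.contDiff h'.contDiff ξ (mod_cast le_top)).trans ?_
  rw [Finset.sum_mul]
  refine Finset.sum_le_sum fun k hk => ?_
  have hk' : k ≤ i := by simpa [Nat.lt_succ_iff] using hk
  have e : (1 + ‖ξ‖ ^ 2) ^ ((m + m' - i) / 2)
      = (1 + ‖ξ‖ ^ 2) ^ ((m - k) / 2) * (1 + ‖ξ‖ ^ 2) ^ ((m' - (i - k : ℕ)) / 2) := by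
    rw [← Real.rpow_add (by positivity), Nat.cast_sub hk']
    congr 1
    ring
  rw [e]
  calc _ ≤ (i.choose k : ℝ) * (C k * (1 + ‖ξ‖ ^ 2) ^ ((m - k) / 2)) *
        (C' (i - k) * (1 + ‖ξ‖ ^ 2) ^ ((m' - (i - k : ℕ)) / 2)) := by
        gcongr
        · exact mul_nonneg (Nat.cast_nonneg _) (mul_nonneg (h.nonneg k) (by positivity))
        · exact h.bound k ξ
        · exact h'.bound (i - k) ξ
    _ = _ := by ring

theorem sub (h : SymbolBound m C p) (h' : SymbolBound m C' p') :
    SymbolBound m (fun i => C i + C' i) (fun ξ => p ξ - p' ξ) := by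
  refine ⟨h.contDiff.sub h'.contDiff, fun i ξ => ?_⟩
  have e : iteratedFDeriv ℝ i (fun ξ => p ξ - p' ξ) ξ
      = iteratedFDeriv ℝ i p ξ - iteratedFDeriv ℝ i p' ξ :=
    iteratedFDeriv_sub_apply (h.contDiff.of_le (mod_cast le_top)).contDiffAt
      (h'.contDiff.of_le (mod_cast le_top)).contDiffAt
  rw [e, add_mul]
  exact (norm_sub_le _ _).trans (add_le_add (h.bound i ξ) (h'.bound i ξ))

end SymbolBound

/-- Dilates of a Schwartz function along a subspace are symbols of order `0`, uniformly. -/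
theorem SchwartzMap.exists_symbolBound_dilate {n : ℕ} {V : Type*} [NormedAddCommGroup V]
    [NormedSpace ℝ V] (f : 𝓢(V, ℂ)) :
    ∃ C : ℕ → ℝ, ∀ (v : V) (ε : ℝ) (L : Rn n →L[ℝ] V), 0 ≤ ε → ε ≤ 1 → ‖L‖ ≤ 1 →
      (∀ ξ, ε * ‖ξ‖ ≤ ‖v + ε • L ξ‖) → SymbolBound 0 C (fun ξ => f (v + ε • L ξ)) := by
  refine ⟨fun i => 2 ^ i * (Finset.Iic (i, i)).sup
    (fun m => SchwartzMap.seminorm ℝ m.1 m.2) f, fun v ε L hε hε' hL hv => ?_⟩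
  have hf : ContDiff ℝ ∞ (fun w => f (v + w)) := (f.smooth ⊤).comp (contDiff_const.add contDiff_id)
  have hcomp : (fun ξ => f (v + ε • L ξ)) = (fun w => f (v + w)) ∘ (ε • L : Rn n →L[ℝ] V) := by
    ext ξ; simp
  refine ⟨hcomp ▸ hf.comp (ε • L).contDiff, fun i ξ => ?_⟩
  rw [hcomp, (ε • L).iteratedFDeriv_comp_right hf ξ (mod_cast le_top)]
  refine (ContinuousMultilinearMap.norm_compContinuousLinearMap_le _ _).trans ?_
  rw [iteratedFDeriv_comp_add_left, Finset.prod_const, Finset.card_univ, Fintype.card_fin]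
  set S := (Finset.Iic (i, i)).sup (fun m => SchwartzMap.seminorm ℝ m.1 m.2) f with hS
  have hS0 : 0 ≤ S := apply_nonneg _ _
  have h1 : (1 + ‖v + (ε • L) ξ‖) ^ i * ‖iteratedFDeriv ℝ i f (v + (ε • L) ξ)‖ ≤ 2 ^ i * S :=
    SchwartzMap.one_add_le_sup_seminorm_apply (𝕜 := ℝ) (m := (i, i)) le_rfl le_rfl f _
  have hL' : ‖ε • L‖ ≤ ε := by
    rw [norm_smul, Real.norm_of_nonneg hε]
    exact mul_le_of_le_one_right hε hL
  -- Each derivative produces a factor `‖ε • L‖`. This inequality trades it for a factor `(1 +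
  -- ‖ξ‖)⁻¹` at the cost of one Schwartz weight, which makes the constants independent of `ε`, `v`
  -- and `L`.
  have h2 : ‖ε • L‖ * (1 + ‖ξ‖) ≤ 1 + ‖v + (ε • L) ξ‖ := by
    have := hv ξ
    have h3 := mul_le_mul_of_nonneg_right hL' (by positivity : 0 ≤ 1 + ‖ξ‖)
    simp only [smul_apply]
    linarith
  have h3 : (1 + ‖ξ‖) ^ i * (‖iteratedFDeriv ℝ i f (v + (ε • L) ξ)‖ * ‖ε • L‖ ^ i)
      ≤ 2 ^ i * S := by
    refine le_trans ?_ h1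
    calc _ = (‖ε • L‖ * (1 + ‖ξ‖)) ^ i * ‖iteratedFDeriv ℝ i f (v + (ε • L) ξ)‖ := by
          rw [mul_pow]; ring
      _ ≤ _ := by gcongr
  have h4 : (1 + ‖ξ‖ ^ 2) ^ ((0 - (i : ℝ)) / 2) * (1 + ‖ξ‖) ^ i ≥ 1 := by
    have : (1 + ‖ξ‖ ^ 2) ^ ((i : ℝ) / 2) ≤ (1 + ‖ξ‖) ^ i := by
      rw [← Real.rpow_natCast (1 + ‖ξ‖) i]
      calc (1 + ‖ξ‖ ^ 2) ^ ((i : ℝ) / 2) ≤ ((1 + ‖ξ‖) ^ 2) ^ ((i : ℝ) / 2) := by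
            gcongr
            nlinarith [norm_nonneg ξ]
        _ = _ := by
            rw [← Real.rpow_natCast (1 + ‖ξ‖) 2, ← Real.rpow_mul (by positivity)]
            congr 1
            push_cast; ring
    have hp : 0 < (1 + ‖ξ‖ ^ 2) ^ ((i : ℝ) / 2) := by positivity
    rw [show (0 - (i : ℝ)) / 2 = -((i : ℝ) / 2) by ring, Real.rpow_neg (by positivity), ge_iff_le,
      ← div_eq_inv_mul, le_div_iff₀ hp, one_mul]
    exact this
  have h5 : 0 < (1 + ‖ξ‖ ^ 2) ^ ((0 - (i : ℝ)) / 2) := by positivity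
  calc _ ≤ ((1 + ‖ξ‖ ^ 2) ^ ((0 - (i : ℝ)) / 2) * (1 + ‖ξ‖) ^ i) *
        (‖iteratedFDeriv ℝ i f (v + (ε • L) ξ)‖ * ‖ε • L‖ ^ i) :=
        le_mul_of_one_le_left (by positivity) h4
    _ = (1 + ‖ξ‖ ^ 2) ^ ((0 - (i : ℝ)) / 2) * ((1 + ‖ξ‖) ^ i *
        (‖iteratedFDeriv ℝ i f (v + (ε • L) ξ)‖ * ‖ε • L‖ ^ i)) := by ring
    _ ≤ (1 + ‖ξ‖ ^ 2) ^ ((0 - (i : ℝ)) / 2) * (2 ^ i * S) := by gcongr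
    _ = _ := by ring

/-- A quadratic polynomial has only two nonzero orders of derivatives to check. The form `D ^ i`
with a common `D` of size `⟨x⟩⁻¹` is the input of the composition estimate
`norm_iteratedFDeriv_comp_le'`. -/
theorem norm_iteratedFDeriv_one_add_norm_sq_div_le {n : ℕ} (x : Rn n) (i : ℕ) (hi : 1 ≤ i) :
    ‖iteratedFDeriv ℝ i (fun ξ : Rn n => (1 + ‖ξ‖ ^ 2) / (1 + ‖x‖ ^ 2)) x‖
      ≤ (2 / √(1 + ‖x‖ ^ 2)) ^ i := by
  set R := 1 + ‖x‖ ^ 2 with hR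
  have hR0 : 0 < R := by positivity
  have hs : √R * √R = R := Real.mul_self_sqrt hR0.le
  have hs0 : 0 < √R := Real.sqrt_pos.2 hR0
  have hder : fderiv ℝ (fun ξ : Rn n => (1 + ‖ξ‖ ^ 2) / R) = ⇑((2 / R) • innerSL ℝ (E := Rn n)) := by
    ext1 y
    have h := ((hasStrictFDerivAt_norm_sq (F := Rn n) y).hasFDerivAt.const_add 1).mul_const R⁻¹
    simp only [← div_eq_mul_inv] at h
    rw [h.fderiv]
    ext z
    simp
    ring
  obtain ⟨k, rfl⟩ : ∃ k, i = k + 1 := ⟨i - 1, by omega⟩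
  rw [← norm_iteratedFDeriv_fderiv, hder]
  have hL : ‖innerSL ℝ (E := Rn n)‖ ≤ 1 := norm_innerSL_le _
  rcases k with _ | k
  · have : ‖x‖ ≤ √R := Real.le_sqrt_of_sq_le (by simp [hR])
    simp only [norm_iteratedFDeriv_zero, zero_add, pow_one]
    refine (ContinuousLinearMap.le_opNorm _ _).trans ?_
    rw [norm_smul, Real.norm_of_nonneg (by positivity)]
    calc 2 / R * ‖innerSL ℝ (E := Rn n)‖ * ‖x‖ ≤ 2 / R * 1 * √R := by gcongr
      _ = 2 / √R := by field_simp; rw [Real.sq_sqrt hR0.le]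
  · rw [← norm_iteratedFDeriv_fderiv]
    have : fderiv ℝ ⇑((2 / R) • innerSL ℝ (E := Rn n)) = fun _ => (2 / R) • innerSL ℝ (E := Rn n) := by
      ext1 y
      exact ContinuousLinearMap.fderiv _
    rw [this]
    rcases k with _ | k
    · simp only [norm_iteratedFDeriv_zero]
      rw [norm_smul, Real.norm_of_nonneg (by positivity)]
      calc 2 / R * ‖innerSL ℝ (E := Rn n)‖ ≤ 2 / R * 1 := by gcongr
        _ ≤ 4 / R := by
          rw [mul_one]; gcongr; norm_num
        _ = _ := by
          rw [zero_add, div_pow, Real.sq_sqrt hR0.le]; norm_num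
    · rw [iteratedFDeriv_succ_const]
      simp
      positivity

/-- `⟨ξ⟩^s` is a symbol of order `s`. -/
theorem exists_symbolBound_bessel (n : ℕ) (s : ℝ) :
    ∃ C : ℕ → ℝ, SymbolBound s C (fun ξ : Rn n => (((1 + ‖ξ‖ ^ 2) ^ (s / 2) : ℝ) : ℂ)) := by
  have hsm : ContDiff ℝ ∞ (fun ξ : Rn n => (1 + ‖ξ‖ ^ 2) ^ (s / 2)) :=
    (Function.hasTemperateGrowth_one_add_norm_sq_rpow (Rn n) (s / 2)).1
  refine ⟨fun i => i.factorial * (∑ k ∈ Finset.range (i + 1),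
    ‖Polynomial.eval (s / 2) (descPochhammer ℝ k)‖) * 2 ^ i,
    Complex.ofRealCLM.contDiff.comp hsm, fun i x => ?_⟩
  have e0 : ‖iteratedFDeriv ℝ i (fun ξ : Rn n => (((1 + ‖ξ‖ ^ 2) ^ (s / 2) : ℝ) : ℂ)) x‖
      = ‖iteratedFDeriv ℝ i (fun ξ : Rn n => (1 + ‖ξ‖ ^ 2) ^ (s / 2)) x‖ :=
    Complex.ofRealLI.norm_iteratedFDeriv_comp_left
      (hsm.of_le (mod_cast le_top) : ContDiff ℝ i _).contDiffAt le_rfl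
  rw [e0]
  set R := 1 + ‖x‖ ^ 2 with hR
  have hR0 : 0 < R := by positivity
  -- Dividing by `R = ⟨x⟩²` makes the inner function equal to `1` at the base point, so the
  -- derivatives of `t ^ (s / 2)` enter only at `t = 1`, as constants.
  set g : ℝ → ℝ := fun t => t ^ (s / 2)
  set f : Rn n → ℝ := fun ξ => (1 + ‖ξ‖ ^ 2) / R
  have hfs : ContDiff ℝ ∞ f := (contDiff_const.add (contDiff_norm_sq ℝ)).div_const _
  have hgs : ContDiffOn ℝ ∞ g (Set.Ioi 0) :=
    contDiffOn_fun_id.rpow_const_of_ne fun t ht => (ne_of_gt ht)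
  have hrange : Set.range f ⊆ Set.Ioi 0 := by
    rintro - ⟨ξ, rfl⟩
    simp only [Set.mem_Ioi, f]
    positivity
  have hu : UniqueDiffOn ℝ (Set.Ioi (0 : ℝ)) := isOpen_Ioi.uniqueDiffOn
  have hfx : f x = 1 := div_self hR0.ne'
  have key := norm_iteratedFDeriv_comp_le' (n := i) hrange hu hgs hfs (mod_cast le_top) x
    (C := ∑ k ∈ Finset.range (i + 1), ‖Polynomial.eval (s / 2) (descPochhammer ℝ k)‖)
    (D := 2 / √R) (by
      intro k hk
      have h1 : ContDiffAt ℝ k g 1 := Real.contDiffAt_rpow_const (Or.inl one_ne_zero)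
      rw [hfx, norm_iteratedFDerivWithin_eq_norm_iteratedDerivWithin,
        iteratedDerivWithin_eq_iteratedDeriv hu h1 (by simp), iteratedDeriv_eq_iterate,
        Real.iter_deriv_rpow_const]
      simp only [Real.one_rpow, mul_one]
      exact Finset.single_le_sum (f := fun k => ‖Polynomial.eval (s / 2) (descPochhammer ℝ k)‖)
        (fun _ _ => norm_nonneg _) (Finset.mem_range.2 (by omega)))
    (fun k hk _ => norm_iteratedFDeriv_one_add_norm_sq_div_le x k hk)
  have e1 : (fun ξ : Rn n => (1 + ‖ξ‖ ^ 2) ^ (s / 2)) = R ^ (s / 2) • (g ∘ f) := by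
    ext ξ
    simp only [g, f, Pi.smul_apply, Function.comp_apply, smul_eq_mul]
    rw [← Real.mul_rpow hR0.le (by positivity)]
    congr 1
    field_simp
  have hgf : ContDiff ℝ ∞ (g ∘ f) := hgs.comp_contDiff hfs (fun ξ => hrange ⟨ξ, rfl⟩)
  rw [e1, iteratedFDeriv_const_smul_apply (hgf.of_le (mod_cast le_top)).contDiffAt, norm_smul,
    Real.norm_of_nonneg (by positivity)]
  have e2 : R ^ ((s - i) / 2) = R ^ (s / 2) * (1 / √R) ^ i := by
    rw [sub_div, Real.rpow_sub hR0, one_div, inv_pow, ← div_eq_mul_inv]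
    congr 1
    rw [Real.sqrt_eq_rpow, ← Real.rpow_natCast, ← Real.rpow_mul hR0.le]
    congr 1
    ring
  rw [e2]
  calc _ ≤ R ^ (s / 2) * (i.factorial * (∑ k ∈ Finset.range (i + 1),
        ‖Polynomial.eval (s / 2) (descPochhammer ℝ k)‖) * (2 / √R) ^ i) := by gcongr
    _ = _ := by
      rw [div_pow, div_pow]; ring

/-! ### A dyadic partition of unity -/

/-- A smooth function that is `1` on the unit ball and `0` outside the ball of radius `2`. -/
noncomputable def lowCutoff (n : ℕ) : 𝓢(Rn n, ℂ) :=
  HasCompactSupport.toSchwartzMap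
    (f := fun ξ => (((⟨1, 2, one_pos, one_lt_two⟩ : ContDiffBump (0 : Rn n)) ξ : ℝ) : ℂ))
    ((ContDiffBump.hasCompactSupport _).comp_left (g := Complex.ofReal) rfl)
    (Complex.ofRealCLM.contDiff.comp (ContDiffBump.contDiff _))

theorem lowCutoff_apply (n : ℕ) (ξ : Rn n) :
    lowCutoff n ξ = (((⟨1, 2, one_pos, one_lt_two⟩ : ContDiffBump (0 : Rn n)) ξ : ℝ) : ℂ) := rfl

theorem lowCutoff_eq_one {n : ℕ} {ξ : Rn n} (h : ‖ξ‖ ≤ 1) : lowCutoff n ξ = 1 := by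
  rw [lowCutoff_apply, ContDiffBump.one_of_mem_closedBall _ (by simpa using h)]
  simp

theorem lowCutoff_eq_zero {n : ℕ} {ξ : Rn n} (h : 2 ≤ ‖ξ‖) : lowCutoff n ξ = 0 := by
  rw [lowCutoff_apply, ContDiffBump.zero_of_le_dist _ (by simpa using h)]
  simp

theorem norm_lowCutoff_le_one {n : ℕ} (ξ : Rn n) : ‖lowCutoff n ξ‖ ≤ 1 := by
  rw [lowCutoff_apply, Complex.norm_real, Real.norm_of_nonneg (ContDiffBump.nonneg _)]
  exact ContDiffBump.le_one _

/-- The `j`-th function of the dyadic partition of unity. -/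
noncomputable def dyadic (n : ℕ) : ℕ → Rn n → ℂ
  | 0, ξ => lowCutoff n ξ
  | j + 1, ξ => lowCutoff n (((2 : ℝ) ^ (j + 1))⁻¹ • ξ) - lowCutoff n (((2 : ℝ) ^ j)⁻¹ • ξ)

theorem sum_dyadic (n J : ℕ) (ξ : Rn n) :
    ∑ j ∈ Finset.range (J + 1), dyadic n j ξ = lowCutoff n (((2 : ℝ) ^ J)⁻¹ • ξ) := by
  induction J with
  | zero => simp [dyadic]
  | succ J ih => rw [Finset.sum_range_succ, ih]; simp [dyadic]

theorem norm_inv_two_pow_smul {n : ℕ} (j : ℕ) (ξ : Rn n) :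
    ‖((2 : ℝ) ^ j)⁻¹ • ξ‖ = ‖ξ‖ / 2 ^ j := by
  rw [norm_smul, norm_inv, Real.norm_of_nonneg (by positivity), div_eq_inv_mul]

theorem dyadic_eq_zero_of_le_norm {n j : ℕ} {ξ : Rn n} (h : 2 ^ (j + 1) ≤ ‖ξ‖) :
    dyadic n j ξ = 0 := by
  have h2 : (2 : ℝ) ≤ ‖((2 : ℝ) ^ j)⁻¹ • ξ‖ := by
    rw [norm_inv_two_pow_smul, le_div_iff₀ (by positivity)]
    rw [pow_succ] at h; linarith
  cases j with
  | zero => exact lowCutoff_eq_zero (by simpa using h)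
  | succ j =>
    have h3 : (2 : ℝ) ≤ ‖((2 : ℝ) ^ j)⁻¹ • ξ‖ := by
      refine h2.trans ?_
      rw [norm_inv_two_pow_smul, norm_inv_two_pow_smul]
      gcongr <;> norm_num
    simp [dyadic, lowCutoff_eq_zero h2, lowCutoff_eq_zero h3]

theorem dyadic_succ_eq_zero_of_norm_le {n j : ℕ} {ξ : Rn n} (h : ‖ξ‖ ≤ 2 ^ j) :
    dyadic n (j + 1) ξ = 0 := by
  have h3 : ‖((2 : ℝ) ^ j)⁻¹ • ξ‖ ≤ 1 := by
    rw [norm_inv_two_pow_smul, div_le_one (by positivity)]; exact h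
  have h2 : ‖((2 : ℝ) ^ (j + 1))⁻¹ • ξ‖ ≤ 1 := by
    refine le_trans ?_ h3
    rw [norm_inv_two_pow_smul, norm_inv_two_pow_smul]
    gcongr <;> norm_num
  simp [dyadic, lowCutoff_eq_one h2, lowCutoff_eq_one h3]

theorem exists_symbolBound_dyadic (n : ℕ) : ∃ C : ℕ → ℝ, ∀ j, SymbolBound 0 C (dyadic n j) := by
  obtain ⟨C, hC⟩ := (lowCutoff n).exists_symbolBound_dilate (n := n)
  have h (j : ℕ) : SymbolBound 0 C (fun ξ => lowCutoff n (((2 : ℝ) ^ j)⁻¹ • ξ)) := by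
    have := hC 0 ((2 : ℝ) ^ j)⁻¹ (ContinuousLinearMap.id ℝ _) (by positivity)
      (inv_le_one_of_one_le₀ (one_le_pow₀ one_le_two)) ContinuousLinearMap.norm_id_le
      (fun ξ => by simp [norm_smul])
    simpa using this
  refine ⟨fun i => C i + C i, fun j => ?_⟩
  cases j with
  | zero =>
    have h0 := h 0
    refine ⟨(lowCutoff n).smooth ⊤, fun i ξ => ?_⟩
    have := h0.bound i ξ
    simp only [pow_zero, inv_one, one_smul] at this
    refine this.trans ?_
    gcongr
    exact le_add_of_nonneg_left (h0.nonneg i)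
  | succ j => exact (h (j + 1)).sub (h j)

theorem continuous_dyadic (n j : ℕ) : Continuous (dyadic n j) :=
  ((exists_symbolBound_dyadic n).choose_spec j).contDiff.continuous

theorem tsupport_dyadic_subset_closedBall (n j : ℕ) :
    tsupport (dyadic n j) ⊆ Metric.closedBall 0 (2 ^ (j + 1)) := by
  refine closure_minimal (fun ξ hξ => ?_) Metric.isClosed_closedBall
  by_contra h
  exact hξ (dyadic_eq_zero_of_le_norm (by simpa using (not_le.1 (by simpa using h)).le))

theorem hasCompactSupport_dyadic (n j : ℕ) : HasCompactSupport (dyadic n j) :=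
  (isCompact_closedBall 0 _).of_isClosed_subset (isClosed_tsupport _)
    (tsupport_dyadic_subset_closedBall n j)

theorem le_norm_of_mem_tsupport_dyadic_succ {n j : ℕ} {ξ : Rn n}
    (h : ξ ∈ tsupport (dyadic n (j + 1))) : 2 ^ j ≤ ‖ξ‖ := by
  have : tsupport (dyadic n (j + 1)) ⊆ {ξ | 2 ^ j ≤ ‖ξ‖} := by
    refine closure_minimal (fun ξ hξ => ?_) (isClosed_le continuous_const continuous_norm)
    by_contra h
    exact hξ (dyadic_succ_eq_zero_of_norm_le (not_le.1 h).le)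
  exact this h

theorem rpow_le_four_rpow_mul {t b : ℝ} (hb : 0 < b) (h1 : b / 4 ≤ t) (h2 : t ≤ 4 * b) (r : ℝ) :
    t ^ r ≤ 4 ^ |r| * b ^ r := by
  have ht : 0 < t := lt_of_lt_of_le (by positivity) h1
  rcases le_or_gt 0 r with hr | hr
  · rw [abs_of_nonneg hr, ← Real.mul_rpow (by norm_num) hb.le]
    gcongr
  · calc t ^ r ≤ (b / 4) ^ r := Real.rpow_le_rpow_of_nonpos (by positivity) h1 hr.le
      _ = _ := by
        rw [abs_of_neg hr, Real.div_rpow hb.le (by norm_num), Real.rpow_neg (by norm_num)]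
        field_simp

theorem bracket_rpow_le_of_mem_tsupport_dyadic {n j : ℕ} {ξ : Rn n}
    (h : ξ ∈ tsupport (dyadic n j)) (r : ℝ) :
    (1 + ‖ξ‖ ^ 2) ^ (r / 2) ≤ 4 ^ |r| * ((2 : ℝ) ^ j) ^ r := by
  have e : (1 + ‖ξ‖ ^ 2) ^ (r / 2) = (√(1 + ‖ξ‖ ^ 2)) ^ r := by
    rw [Real.sqrt_eq_rpow, ← Real.rpow_mul (by positivity)]
    congr 1; ring
  rw [e]
  have h1 : ‖ξ‖ ≤ 2 * 2 ^ j := by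
    have := tsupport_dyadic_subset_closedBall n j h
    rw [mem_closedBall_zero_iff, pow_succ] at this
    linarith
  have hj : (1 : ℝ) ≤ 2 ^ j := one_le_pow₀ one_le_two
  apply rpow_le_four_rpow_mul (by positivity)
  · apply Real.le_sqrt_of_sq_le
    cases j with
    | zero => norm_num; nlinarith [norm_nonneg ξ]
    | succ j =>
      have := le_norm_of_mem_tsupport_dyadic_succ h
      have h0 : (0 : ℝ) < 2 ^ j := by positivity
      rw [pow_succ 2 j]
      nlinarith
  · apply Real.sqrt_le_iff.2 ⟨by positivity, ?_⟩
    nlinarith [norm_nonneg ξ]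

/-! ### Fourier transforms of dyadic pieces of symbols -/

theorem norm_fourier_le_integral_norm {n : ℕ} {F : Type*} [NormedAddCommGroup F] [NormedSpace ℂ F]
    (f : Rn n → F) (w : Rn n) : ‖𝓕 f w‖ ≤ ∫ ξ, ‖f ξ‖ := by
  rw [Real.fourier_eq]
  refine (norm_integral_le_integral_norm _).trans_eq ?_
  simp

/-- Integration by parts without coordinates: the transform of the tensor `D^M b` at `w`, evaluated
on `(w, …, w)`, has modulus `(2π)^M ‖w‖^{2M} ‖𝓕 b w‖`. The operator norm bound costs `‖w‖^M`, and
`(2π)^M ≥ 1` is dropped. -/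
theorem pow_norm_mul_norm_fourier_le {n : ℕ} {b : Rn n → ℂ} (hb : ContDiff ℝ ∞ b)
    (hc : HasCompactSupport b) (M : ℕ) (w : Rn n) :
    ‖w‖ ^ M * ‖𝓕 b w‖ ≤ ∫ ξ, ‖iteratedFDeriv ℝ M b ξ‖ := by
  rcases eq_or_ne w 0 with rfl | hw
  · rcases M with _ | M
    · simpa using norm_fourier_le_integral_norm b 0
    · simp
      exact integral_nonneg fun _ => norm_nonneg _
  have hInt (k : ℕ) : Integrable (iteratedFDeriv ℝ k b) :=
    (hb.continuous_iteratedFDeriv (mod_cast le_top)).integrable_of_hasCompactSupport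
      (hc.iteratedFDeriv k)
  have h := congrFun (Real.fourier_iteratedFDeriv (N := ⊤) hb (fun k _ => hInt k)
    (n := M) (mod_cast le_top)) w
  have h1 : ‖𝓕 (iteratedFDeriv ℝ M b) w (fun _ => w)‖
      = (2 * Real.pi) ^ M * (‖w‖ ^ M * (‖w‖ ^ M * ‖𝓕 b w‖)) := by
    rw [h, VectorFourier.fourierPowSMulRight_apply]
    have hin : |innerSL ℝ w w| = ‖w‖ * ‖w‖ := by
      rw [innerSL_apply_apply, real_inner_self_eq_norm_mul_norm, abs_of_nonneg (by positivity)]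
    simp [abs_of_pos Real.pi_pos, hin]
    ring
  have h2 := (𝓕 (iteratedFDeriv ℝ M b) w).le_opNorm (fun _ => w)
  rw [h1, Finset.prod_const, Finset.card_univ, Fintype.card_fin] at h2
  have h3 := norm_fourier_le_integral_norm (iteratedFDeriv ℝ M b) w
  have hwM : 0 < ‖w‖ ^ M := by positivity
  have h4 : (2 * Real.pi) ^ M * (‖w‖ ^ M * ‖𝓕 b w‖) ≤ ‖𝓕 (iteratedFDeriv ℝ M b) w‖ := by
    refine le_of_mul_le_mul_left ?_ hwM
    calc _ = (2 * Real.pi) ^ M * (‖w‖ ^ M * (‖w‖ ^ M * ‖𝓕 b w‖)) := by ring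
      _ ≤ _ := h2.trans_eq (mul_comm _ _)
  have h5 : (1 : ℝ) ≤ (2 * Real.pi) ^ M := one_le_pow₀ (by nlinarith [Real.pi_gt_three])
  exact (le_mul_of_one_le_left (by positivity) h5).trans (h4.trans h3)

/-- The shell lies in a ball of volume comparable to `2^{jn}`, and `⟨ξ⟩^r` is comparable to `2^{jr}`
on it. A general target is needed because this is applied to derivative tensors too. -/
theorem exists_integral_norm_le_of_dyadic (n : ℕ) (r : ℝ) :
    ∃ K : ℝ, 0 ≤ K ∧ ∀ {F : Type} [NormedAddCommGroup F] (f : Rn n → F) (B : ℝ) (j : ℕ), 0 ≤ B →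
      (∀ ξ, ξ ∉ tsupport (dyadic n j) → f ξ = 0) →
      (∀ ξ ∈ tsupport (dyadic n j), ‖f ξ‖ ≤ B * (1 + ‖ξ‖ ^ 2) ^ (r / 2)) →
      ∫ ξ, ‖f ξ‖ ≤ K * B * ((2 : ℝ) ^ j) ^ (n + r) := by
  refine ⟨4 ^ |r| * (2 ^ n * volume.real (Metric.ball (0 : Rn n) 1)), by positivity,
    fun f B j hB h0 hf => ?_⟩
  have hbound (ξ : Rn n) : ‖f ξ‖ ≤ B * (4 ^ |r| * ((2 : ℝ) ^ j) ^ r) := by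
    by_cases h : ξ ∈ tsupport (dyadic n j)
    · refine (hf ξ h).trans ?_
      gcongr
      exact bracket_rpow_le_of_mem_tsupport_dyadic h _
    · rw [h0 ξ h, norm_zero]
      positivity
  have hzero : ∀ ξ, ξ ∉ Metric.closedBall (0 : Rn n) (2 ^ (j + 1)) → ‖f ξ‖ = 0 := fun ξ hξ => by
    rw [h0 ξ fun h => hξ (tsupport_dyadic_subset_closedBall n j h), norm_zero]
  rw [← setIntegral_eq_integral_of_forall_compl_eq_zero hzero]
  have hfin : volume (Metric.closedBall (0 : Rn n) (2 ^ (j + 1))) < ⊤ := measure_closedBall_lt_top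
  have hle := norm_setIntegral_le_of_norm_le_const (f := fun ξ => ‖f ξ‖) hfin
    (fun ξ _ => by simpa using hbound ξ)
  refine (le_abs_self _).trans (hle.trans ?_)
  have hvol : volume.real (Metric.closedBall (0 : Rn n) (2 ^ (j + 1)))
      = (2 ^ n * ((2 : ℝ) ^ j) ^ n) * volume.real (Metric.ball (0 : Rn n) 1) := by
    rw [measureReal_def, Measure.addHaar_closedBall _ _ (by positivity), ENNReal.toReal_mul,
      ENNReal.toReal_ofReal (by positivity), finrank_euclideanSpace, Fintype.card_fin,
      measureReal_def, pow_succ, mul_pow]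
    ring
  rw [hvol, Real.rpow_add (by positivity), Real.rpow_natCast]
  apply le_of_eq
  ring

theorem SymbolBound.exists_integral_iteratedFDeriv_dyadic_le (n : ℕ) (m : ℝ) (C : ℕ → ℝ) (i : ℕ) :
    ∃ K : ℝ, ∀ p : Rn n → ℂ, SymbolBound m C p → ∀ j : ℕ,
      ∫ ξ, ‖iteratedFDeriv ℝ i (fun ξ => dyadic n j ξ * p ξ) ξ‖ ≤ K * ((2 : ℝ) ^ j) ^ (n + m - i) := by
  obtain ⟨D, hD⟩ := exists_symbolBound_dyadic n
  obtain ⟨K, hK0, hK⟩ := exists_integral_norm_le_of_dyadic n (m - i)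
  refine ⟨K * ∑ k ∈ Finset.range (i + 1), (i.choose k : ℝ) * D k * C (i - k), fun p hp j => ?_⟩
  have hb := (hD j).mul hp
  rw [add_sub_assoc]
  refine hK _ _ j (hb.nonneg i) (fun ξ h => ?_) (fun ξ _ => ?_)
  · by_contra h'
    exact h (tsupport_mul_subset_left (support_iteratedFDeriv_subset i h'))
  · simpa using hb.bound i ξ

/-- Decay of the Fourier transform of the dyadic pieces of a symbol. -/
theorem SymbolBound.exists_norm_fourier_dyadic_le (n : ℕ) (m : ℝ) (C : ℕ → ℝ) (M : ℕ) :
    ∃ K : ℝ, 0 ≤ K ∧ ∀ p : Rn n → ℂ, SymbolBound m C p → ∀ (j : ℕ) (w : Rn n),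
      ‖𝓕 (fun ξ => dyadic n j ξ * p ξ) w‖ * (1 + 2 ^ j * ‖w‖) ^ M
        ≤ K * ((2 : ℝ) ^ j) ^ (n + m) := by
  obtain ⟨K₀, h₀⟩ := exists_integral_iteratedFDeriv_dyadic_le n m C 0
  obtain ⟨K₁, h₁⟩ := exists_integral_iteratedFDeriv_dyadic_le n m C M
  refine ⟨2 ^ M * (|K₀| + |K₁|), by positivity, fun p hp j w => ?_⟩
  have hs : ContDiff ℝ ∞ (fun ξ => dyadic n j ξ * p ξ) :=
    ((exists_symbolBound_dyadic n).choose_spec j).contDiff.mul hp.contDiff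
  have hc : HasCompactSupport (fun ξ => dyadic n j ξ * p ξ) := (hasCompactSupport_dyadic n j).mul_right
  have a₀ := (pow_norm_mul_norm_fourier_le hs hc 0 w).trans (h₀ p hp j)
  have a₁ := (pow_norm_mul_norm_fourier_le hs hc M w).trans (h₁ p hp j)
  simp only [pow_zero, one_mul, Nat.cast_zero, sub_zero] at a₀
  set B := ‖𝓕 (fun ξ => dyadic n j ξ * p ξ) w‖
  have e : ((2 : ℝ) ^ j) ^ ((n : ℝ) + m) = ((2 : ℝ) ^ j) ^ M * ((2 : ℝ) ^ j) ^ ((n : ℝ) + m - M) := by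
    rw [← Real.rpow_natCast _ M, ← Real.rpow_add (by positivity)]
    congr 1; ring
  have hP : 0 < ((2 : ℝ) ^ j) ^ ((n : ℝ) + m) := by positivity
  have a₂ : (2 ^ j * ‖w‖) ^ M * B ≤ K₁ * ((2 : ℝ) ^ j) ^ ((n : ℝ) + m) := by
    rw [e, mul_pow]
    calc _ = (2 ^ j) ^ M * (‖w‖ ^ M * B) := by ring
      _ ≤ (2 ^ j) ^ M * (K₁ * ((2 : ℝ) ^ j) ^ ((n : ℝ) + m - M)) := by gcongr
      _ = _ := by ring
  have a₃ : (1 + 2 ^ j * ‖w‖) ^ M ≤ 2 ^ M * (1 + (2 ^ j * ‖w‖) ^ M) := by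
    have := add_pow_le (by norm_num : (0 : ℝ) ≤ 1) (by positivity : 0 ≤ 2 ^ j * ‖w‖) M
    rw [one_pow] at this
    refine this.trans ?_
    gcongr
    · norm_num
    · omega
  calc B * (1 + 2 ^ j * ‖w‖) ^ M ≤ B * (2 ^ M * (1 + (2 ^ j * ‖w‖) ^ M)) := by gcongr
    _ = 2 ^ M * (B + (2 ^ j * ‖w‖) ^ M * B) := by ring
    _ ≤ 2 ^ M * (|K₀| * ((2 : ℝ) ^ j) ^ ((n : ℝ) + m) + |K₁| * ((2 : ℝ) ^ j) ^ ((n : ℝ) + m)) := by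
        have b₀ := a₀.trans (mul_le_mul_of_nonneg_right (le_abs_self K₀) hP.le)
        have b₂ := a₂.trans (mul_le_mul_of_nonneg_right (le_abs_self K₁) hP.le)
        exact mul_le_mul_of_nonneg_left (add_le_add b₀ b₂) (by positivity)
    _ = _ := by ring

/-! ### Taylor expansion of Hölder functions -/

section Taylor

variable {F : Type*} [NormedAddCommGroup F] [NormedSpace ℝ F]

theorem hasDerivAt_taylor_sum (c : ℕ → F) (k : ℕ) (t : ℝ) :
    HasDerivAt (fun t : ℝ => ∑ i ∈ Finset.range (k + 1), (t ^ i / i.factorial) • c i)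
      (∑ i ∈ Finset.range k, (t ^ i / i.factorial) • c (i + 1)) t := by
  have h : ∀ i ∈ Finset.range k, HasDerivAt
      (fun t : ℝ => (t ^ (i + 1) / (i + 1).factorial) • c (i + 1))
      ((t ^ i / i.factorial) • c (i + 1)) t := by
    intro i _
    have := ((hasDerivAt_pow (i + 1) t).div_const ((i + 1).factorial : ℝ)).smul_const (c (i + 1))
    convert this using 2
    rw [Nat.factorial_succ]
    push_cast
    field_simp
    try simp
  have h2 := (HasDerivAt.fun_sum h).add_const (c 0)
  convert h2 using 2 with s
  rw [Finset.sum_range_succ']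
  simp

/-- The derivative of the remainder of `g` is the remainder of `deriv g` of one order less, so
induction and the mean value inequality on `[0, 1]` suffice. Only the oscillation of the top
derivative enters, as suits a Hölder condition. -/
theorem norm_sub_taylor_sum_le {A : ℝ} (k : ℕ) (g : ℝ → F) (hg : ContDiff ℝ k g)
    (hA : ∀ t ∈ Set.Icc (0 : ℝ) 1, ‖iteratedDeriv k g t - iteratedDeriv k g 0‖ ≤ A)
    (t : ℝ) (ht : t ∈ Set.Icc (0 : ℝ) 1) :
    ‖g t - ∑ i ∈ Finset.range (k + 1), (t ^ i / i.factorial) • iteratedDeriv i g 0‖ ≤ A := by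
  induction k generalizing g t with
  | zero => simpa using hA t ht
  | succ k ih =>
    have hA0 : 0 ≤ A := (norm_nonneg _).trans (hA 0 (by simp))
    have hg1 : ContDiff ℝ 1 g := hg.of_le (by exact_mod_cast Nat.succ_le_succ (Nat.zero_le k))
    have hg' : ContDiff ℝ k (deriv g) := by
      have := (contDiff_succ_iff_deriv (n := (k : ℕ∞ω))).1 (by exact_mod_cast hg)
      exact this.2.2
    have ih' := ih (deriv g) hg' (fun t ht => by
      simpa only [iteratedDeriv_succ'] using hA t ht)
    set h : ℝ → F := fun t =>
      g t - ∑ i ∈ Finset.range (k + 1 + 1), (t ^ i / i.factorial) • iteratedDeriv i g 0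
    have hder (s : ℝ) : HasDerivAt h (deriv g s - ∑ i ∈ Finset.range (k + 1),
        (s ^ i / i.factorial) • iteratedDeriv i (deriv g) 0) s := by
      have h1 := (hg1.differentiable one_ne_zero s).hasDerivAt
      have h2 := hasDerivAt_taylor_sum (fun i => iteratedDeriv i g 0) (k + 1) s
      simpa only [iteratedDeriv_succ'] using h1.fun_sub h2
    have hmv := norm_image_sub_le_of_norm_deriv_le_segment' (f := h) (a := 0) (b := 1) (C := A)
      (fun s _ => (hder s).hasDerivWithinAt)
      (fun s hs => ih' s (Set.Ico_subset_Icc_self hs)) t ht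
    have h0 : h 0 = 0 := by
      simp only [h]
      rw [Finset.sum_range_succ']
      simp
    rw [h0, sub_zero, sub_zero] at hmv
    exact hmv.trans (mul_le_of_le_one_right hA0 ht.2)

variable {V : Type*} [NormedAddCommGroup V] [NormedSpace ℝ V]

theorem iteratedDeriv_comp_line {f : V → F} {k : ℕ} (hf : ContDiff ℝ k f) (x v : V) {i : ℕ}
    (hi : i ≤ k) (t : ℝ) :
    iteratedDeriv i (fun t : ℝ => f (x + t • v)) t
      = iteratedFDeriv ℝ i f (x + t • v) (fun _ => v) := by
  have hf' : ContDiff ℝ k (fun w => f (x + w)) := hf.comp (contDiff_const.add contDiff_id)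
  have hcomp : (fun t : ℝ => f (x + t • v))
      = (fun w => f (x + w)) ∘ (ContinuousLinearMap.toSpanSingleton ℝ v) := by
    ext t; simp
  rw [iteratedDeriv_eq_iteratedFDeriv, hcomp,
    (ContinuousLinearMap.toSpanSingleton ℝ v).iteratedFDeriv_comp_right hf' t (mod_cast hi),
    iteratedFDeriv_comp_add_left]
  simp

theorem HasHolderBound.nonneg {τ C : ℝ} {f : V → F} (h : HasHolderBound τ C f) : 0 ≤ C :=
  (norm_nonneg _).trans (h.bound 0 (Nat.zero_le _) 0)

/-- The `⌈τ⌉₊` terms are those of order `i < τ`. For non-integer `τ` they include the order `⌊τ⌋₊`,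
and the Hölder condition bounds the remainder. For integer `τ` the top term is left out and bounded
separately: `2C` from the oscillation plus `C` from that term gives the constant `3`. -/
theorem HasHolderBound.norm_sub_taylor_le {τ C : ℝ} {f : V → F} (hτ : 0 < τ)
    (h : HasHolderBound τ C f) (x v : V) :
    ‖f (x + v) - ∑ i ∈ Finset.range ⌈τ⌉₊,
      (1 / i.factorial : ℝ) • iteratedFDeriv ℝ i f x (fun _ => v)‖ ≤ 3 * C * ‖v‖ ^ τ := by
  have hC := h.nonneg
  set k := ⌊τ⌋₊ with hk
  have hkτ : (k : ℝ) ≤ τ := Nat.floor_le hτ.le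
  set g : ℝ → F := fun t => f (x + t • v)
  have hg : ContDiff ℝ k g :=
    h.contDiff.comp (contDiff_const.add (contDiff_id.smul contDiff_const))
  have hgi (i : ℕ) (hi : i ≤ k) (t : ℝ) := iteratedDeriv_comp_line h.contDiff x v hi t
  have hdiff (t : ℝ) : ‖iteratedDeriv k g t - iteratedDeriv k g 0‖
      ≤ ‖iteratedFDeriv ℝ k f (x + t • v) - iteratedFDeriv ℝ k f x‖ * ‖v‖ ^ k := by
    rw [hgi k le_rfl, hgi k le_rfl, zero_smul, add_zero, ← sub_apply]
    refine (ContinuousMultilinearMap.le_opNorm _ _).trans_eq ?_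
    simp
  have hsum (N : ℕ) (hN : N ≤ k + 1) : ∑ i ∈ Finset.range N,
      (1 / i.factorial : ℝ) • iteratedFDeriv ℝ i f x (fun _ => v)
      = ∑ i ∈ Finset.range N, ((1 : ℝ) ^ i / i.factorial) • iteratedDeriv i g 0 := by
    refine Finset.sum_congr rfl fun i hi => ?_
    rw [hgi i (by have := Finset.mem_range.1 hi; omega), zero_smul, add_zero, one_pow]
  have hg1 : f (x + v) = g 1 := by simp [g]
  rcases hkτ.lt_or_eq with hlt | heq
  · have hceil : ⌈τ⌉₊ = k + 1 := by
      rw [Nat.ceil_eq_iff (by omega)]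
      simp only [add_tsub_cancel_right]
      exact ⟨hlt, by push_cast; exact (Nat.lt_floor_add_one τ).le⟩
    have hA : ∀ t ∈ Set.Icc (0 : ℝ) 1,
        ‖iteratedDeriv k g t - iteratedDeriv k g 0‖ ≤ C * ‖v‖ ^ τ := by
      intro t ht
      refine (hdiff t).trans ?_
      have h1 := h.holder hlt (x + t • v) x
      rw [add_sub_cancel_left] at h1
      have h2 : ‖t • v‖ ≤ ‖v‖ := by
        rw [norm_smul, Real.norm_of_nonneg ht.1]
        exact mul_le_of_le_one_left (norm_nonneg _) ht.2
      have h3 : ‖v‖ ^ τ = ‖v‖ ^ (τ - k) * ‖v‖ ^ k := by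
        rw [← Real.rpow_natCast, ← Real.rpow_add_of_nonneg (norm_nonneg _) (by linarith)
          (Nat.cast_nonneg _)]
        congr 1; ring
      rw [h3, ← mul_assoc]
      gcongr
      exact h1.trans (by gcongr)
    have := norm_sub_taylor_sum_le k g hg hA 1 (by simp)
    rw [hceil, hsum _ le_rfl, hg1]
    refine this.trans ?_
    have : 0 ≤ C * ‖v‖ ^ τ := by positivity
    linarith
  · have hceil : ⌈τ⌉₊ = k := by rw [← heq, Nat.ceil_natCast]
    have hv : ‖v‖ ^ τ = ‖v‖ ^ k := by rw [← heq, Real.rpow_natCast]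
    have hA : ∀ t ∈ Set.Icc (0 : ℝ) 1,
        ‖iteratedDeriv k g t - iteratedDeriv k g 0‖ ≤ 2 * C * ‖v‖ ^ k := by
      intro t ht
      refine (hdiff t).trans ?_
      gcongr
      refine (norm_sub_le _ _).trans ?_
      have h1 := h.bound k le_rfl (x + t • v)
      have h2 := h.bound k le_rfl x
      linarith
    have h1 := norm_sub_taylor_sum_le k g hg hA 1 (by simp)
    rw [hceil, hsum _ (by omega), hg1, hv]
    rw [Finset.sum_range_succ] at h1
    set S := ∑ i ∈ Finset.range k, ((1 : ℝ) ^ i / i.factorial) • iteratedDeriv i g 0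
    set T := ((1 : ℝ) ^ k / k.factorial) • iteratedDeriv k g 0 with hT
    have h2 : ‖T‖ ≤ C * ‖v‖ ^ k := by
      rw [hT, norm_smul, hgi k le_rfl, zero_smul, add_zero, one_pow,
        Real.norm_of_nonneg (by positivity)]
      have h3 : (1 : ℝ) / k.factorial ≤ 1 := by
        rw [div_le_one (by positivity)]
        exact_mod_cast Nat.one_le_iff_ne_zero.2 (Nat.factorial_ne_zero k)
      refine (mul_le_of_le_one_left (norm_nonneg _) h3).trans ?_
      refine (ContinuousMultilinearMap.le_opNorm _ _).trans ?_
      simp only [Finset.prod_const, Finset.card_univ, Fintype.card_fin]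
      gcongr
      exact h.bound k le_rfl x
    calc ‖g 1 - S‖ = ‖(g 1 - (S + T)) + T‖ := by congr 1; abel
      _ ≤ 2 * C * ‖v‖ ^ k + C * ‖v‖ ^ k := (norm_add_le _ _).trans (add_le_add h1 h2)
      _ = _ := by ring

/-- If all derivatives of order less than `τ` vanish at a point, then `f` is small there to
order `τ`. -/
theorem HasHolderBound.norm_le_of_iteratedFDeriv_eq_zero {τ C : ℝ} {f : V → F} (hτ : 0 < τ)
    (h : HasHolderBound τ C f) (x v : V)
    (h0 : ∀ i : ℕ, (i : ℝ) < τ → iteratedFDeriv ℝ i f x = 0) :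
    ‖f (x + v)‖ ≤ 3 * C * ‖v‖ ^ τ := by
  have := h.norm_sub_taylor_le hτ x v
  rwa [Finset.sum_eq_zero, sub_zero] at this
  intro i hi
  rw [h0 i (Nat.lt_ceil.1 (Finset.mem_range.1 hi))]
  simp

theorem HasHolderBound.mono {τ C C' : ℝ} {f : V → F} (h : HasHolderBound τ C f) (hC : C ≤ C') :
    HasHolderBound τ C' f :=
  ⟨h.contDiff, fun j hj x => (h.bound j hj x).trans hC,
    fun hk x y => (h.holder hk x y).trans (by gcongr)⟩

theorem HasHolderBound.linearIsometry_comp {G : Type*} [NormedAddCommGroup G] [NormedSpace ℝ G]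
    {τ C : ℝ} {f : V → F} (h : HasHolderBound τ C f) (e : F →ₗᵢ[ℝ] G) :
    HasHolderBound τ C (fun x => e (f x)) := by
  refine ⟨e.contDiff.comp h.contDiff, fun j hj x => ?_, fun hk x y => ?_⟩
  · rw [show (fun x => e (f x)) = e ∘ f from rfl,
      e.norm_iteratedFDeriv_comp_left (h.contDiff.contDiffAt) (mod_cast hj)]
    exact h.bound j hj x
  · have hc (z : V) : iteratedFDeriv ℝ ⌊τ⌋₊ (fun x => e (f x)) z
        = e.toContinuousLinearMap.compContinuousMultilinearMap (iteratedFDeriv ℝ ⌊τ⌋₊ f z) :=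
      e.toContinuousLinearMap.iteratedFDeriv_comp_left h.contDiff.contDiffAt le_rfl
    rw [hc, hc]
    have : e.toContinuousLinearMap.compContinuousMultilinearMap (iteratedFDeriv ℝ ⌊τ⌋₊ f x)
        - e.toContinuousLinearMap.compContinuousMultilinearMap (iteratedFDeriv ℝ ⌊τ⌋₊ f y)
        = e.toContinuousLinearMap.compContinuousMultilinearMap
          (iteratedFDeriv ℝ ⌊τ⌋₊ f x - iteratedFDeriv ℝ ⌊τ⌋₊ f y) := by
      ext; simp
    rw [this, e.norm_compContinuousMultilinearMap]
    exact h.holder hk x y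

end Taylor

/-! ### Hölder symbols frozen in space or in frequency. -/

namespace IsHolderSymbol

variable {V : Type*} [NormedAddCommGroup V] [NormedSpace ℝ V] {n : ℕ} {τ m m' : ℝ}
  {a : V → Rn n → ℂ}

theorem exists_symbolBound (ha : IsHolderSymbol τ m a) :
    ∃ C : ℕ → ℝ, ∀ X, SymbolBound m C (a X) := by
  choose C hC using ha.bound
  refine ⟨C, fun X => ⟨ha.smooth X, fun i ξ => ?_⟩⟩
  simpa using (hC i ξ).bound 0 (Nat.zero_le _) X

theorem exists_hasHolderBound (ha : IsHolderSymbol τ m a) :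
    ∃ C : ℝ, 0 ≤ C ∧ ∀ ξ, HasHolderBound τ (C * (1 + ‖ξ‖ ^ 2) ^ (m / 2)) (fun X => a X ξ) := by
  obtain ⟨C, hC⟩ := ha.bound 0
  refine ⟨C, by simpa using (hC 0).nonneg, fun ξ => ?_⟩
  have := (hC ξ).linearIsometry_comp
    (continuousMultilinearCurryFin0 ℝ (Rn n) ℂ).toLinearIsometry
  simpa using this

theorem mono (ha : IsHolderSymbol τ m a) (hm : m ≤ m') : IsHolderSymbol τ m' a := by
  refine ⟨ha.continuous, ha.smooth, fun j => ?_⟩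
  obtain ⟨C, hC⟩ := ha.bound j
  have hC0 : 0 ≤ C := by simpa using (hC 0).nonneg
  refine ⟨C, fun ξ => (hC ξ).mono ?_⟩
  gcongr
  nlinarith [norm_nonneg ξ]

end IsHolderSymbol

/-- Interpolation between smallness and decay. -/
theorem mul_pow_le_of_interpolate {K A ρ r τ τ' : ℝ} {M N : ℕ} (hK : 0 ≤ K) (hρ : 0 ≤ ρ)
    (hr : 0 ≤ r) (hτ' : 0 < τ') (hττ' : τ' < τ) (hM : N + τ' ≤ M * (1 - τ' / τ))
    (h1 : K ≤ A * (ρ * (1 + r)) ^ τ) (h2 : K * (1 + r) ^ M ≤ A) :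
    K * (1 + r) ^ N ≤ A * ρ ^ τ' := by
  have hA : 0 ≤ A := le_trans (by positivity) h2
  have hτ : 0 < τ := hτ'.trans hττ'
  set θ := τ' / τ with hθ
  have hθ0 : 0 < θ := by positivity
  have hθ1 : θ < 1 := (div_lt_one hτ).2 hττ'
  have h1r : 1 ≤ 1 + r := by linarith
  have h3 : K ≤ A * (1 + r) ^ (-(M : ℝ)) := by
    rw [Real.rpow_neg (by positivity), Real.rpow_natCast, ← div_eq_mul_inv,
      le_div_iff₀ (by positivity)]
    exact h2
  -- Geometric mean of `h1` and `h2` with `θ = τ' / τ`. The first factor leaves `ρ ^ τ'` and the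
  -- growth `(1 + r) ^ τ'`; `hM` makes the decay of the second factor absorb this growth together
  -- with the weight `(1 + r) ^ N`.
  have h4 : K = K ^ θ * K ^ (1 - θ) := by
    rw [← Real.rpow_add_of_nonneg hK hθ0.le (by linarith), add_sub_cancel, Real.rpow_one]
  have hAA : A ^ θ * A ^ (1 - θ) = A := by
    rw [← Real.rpow_add_of_nonneg hA hθ0.le (by linarith), add_sub_cancel, Real.rpow_one]
  have h5 : K ^ θ ≤ A ^ θ * (ρ ^ τ' * (1 + r) ^ τ') := by
    calc K ^ θ ≤ (A * (ρ * (1 + r)) ^ τ) ^ θ := by gcongr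
      _ = _ := by
        rw [Real.mul_rpow hA (by positivity), ← Real.rpow_mul (by positivity), hθ,
          mul_div_cancel₀ _ hτ.ne', Real.mul_rpow hρ (by positivity)]
  have h6 : K ^ (1 - θ) ≤ A ^ (1 - θ) * (1 + r) ^ (-(M : ℝ) * (1 - θ)) := by
    have h1θ : 0 ≤ 1 - θ := by linarith
    calc K ^ (1 - θ) ≤ (A * (1 + r) ^ (-(M : ℝ))) ^ (1 - θ) := by gcongr
      _ = _ := by rw [Real.mul_rpow hA (by positivity), ← Real.rpow_mul (by positivity)]
  have h7 : (1 + r) ^ τ' * (1 + r) ^ (-(M : ℝ) * (1 - θ)) * (1 + r) ^ N ≤ 1 := by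
    rw [← Real.rpow_natCast, ← Real.rpow_add (by positivity), ← Real.rpow_add (by positivity)]
    exact Real.rpow_le_one_of_one_le_of_nonpos h1r (by linarith)
  calc K * (1 + r) ^ N = K ^ θ * K ^ (1 - θ) * (1 + r) ^ N := by rw [← h4]
    _ ≤ (A ^ θ * (ρ ^ τ' * (1 + r) ^ τ')) * (A ^ (1 - θ) * (1 + r) ^ (-(M : ℝ) * (1 - θ)))
        * (1 + r) ^ N := by gcongr
    _ = A ^ θ * A ^ (1 - θ) * ρ ^ τ' *
        ((1 + r) ^ τ' * (1 + r) ^ (-(M : ℝ) * (1 - θ)) * (1 + r) ^ N) := by ring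
    _ ≤ A ^ θ * A ^ (1 - θ) * ρ ^ τ' * 1 := by gcongr
    _ = A * ρ ^ τ' := by rw [hAA, mul_one]

/-! ### The weights dominating the kernels -/

/-- The `L¹`-normalized dyadic weight `2^{jn} (1 + 2^j |z|)^{-n-1}`. -/
noncomputable def dyadicWeight (n j : ℕ) (z : Rn n) : ℝ :=
  ((2 : ℝ) ^ j) ^ n * ((1 + 2 ^ j * ‖z‖) ^ (n + 1))⁻¹

theorem dyadicWeight_nonneg (n j : ℕ) (z : Rn n) : 0 ≤ dyadicWeight n j z := by
  unfold dyadicWeight; positivity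

theorem continuous_dyadicWeight (n j : ℕ) : Continuous (dyadicWeight n j) := by
  unfold dyadicWeight
  refine continuous_const.mul (Continuous.inv₀ (by fun_prop) fun z => by positivity)

theorem integrable_inv_one_add_norm_pow (n : ℕ) :
    Integrable (fun z : Rn n => ((1 + ‖z‖) ^ (n + 1))⁻¹) := by
  have := integrable_one_add_norm (E := Rn n) (μ := volume) (r := n + 1) (by simp)
  refine this.congr (Eventually.of_forall fun z => ?_)
  simp only
  rw [Real.rpow_neg (by positivity)]
  norm_cast

theorem dyadicWeight_eq_comp_smul (n j : ℕ) : dyadicWeight n j =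
    fun z => ((2 : ℝ) ^ j) ^ n * (fun z : Rn n => ((1 + ‖z‖) ^ (n + 1))⁻¹) ((2 : ℝ) ^ j • z) := by
  ext z
  simp [dyadicWeight, norm_smul]

theorem integrable_dyadicWeight (n j : ℕ) : Integrable (dyadicWeight n j) := by
  rw [dyadicWeight_eq_comp_smul]
  exact ((integrable_inv_one_add_norm_pow n).comp_smul (by positivity)).const_mul _

theorem integral_dyadicWeight (n j : ℕ) :
    ∫ z, dyadicWeight n j z = ∫ z : Rn n, ((1 + ‖z‖) ^ (n + 1))⁻¹ := by
  rw [dyadicWeight_eq_comp_smul, integral_const_mul,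
    Measure.integral_comp_smul_of_nonneg volume (hR := by positivity)
      (fun z : Rn n => ((1 + ‖z‖) ^ (n + 1))⁻¹), finrank_euclideanSpace, Fintype.card_fin,
    smul_eq_mul, ← mul_assoc, mul_inv_cancel₀ (by positivity), one_mul]

theorem le_mul_dyadicWeight {n j : ℕ} {z : Rn n} {K B r : ℝ}
    (h : K * (1 + 2 ^ j * ‖z‖) ^ (n + 1) ≤ B * ((2 : ℝ) ^ j) ^ (n + r)) :
    K ≤ B * ((2 : ℝ) ^ j) ^ r * dyadicWeight n j z := by
  rw [Real.rpow_add (by positivity), Real.rpow_natCast] at h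
  unfold dyadicWeight
  have hp : 0 < (1 + 2 ^ j * ‖z‖) ^ (n + 1) := by positivity
  rw [← le_div_iff₀ hp] at h
  refine h.trans_eq ?_
  rw [div_eq_mul_inv]; ring

/-! ### Kernels of dyadic pieces -/

/-- Passes from the phase `e^{-2πi⟨·,·⟩}` of `𝓕` to the phase `e^{i(x-y)·ξ}` of `op(a)`. -/
theorem fourier_two_pi_inv_smul {n : ℕ} (b : Rn n → ℂ) (x y : Rn n) :
    𝓕 b ((2 * Real.pi)⁻¹ • (y - x))
      = ∫ ξ, Complex.exp (Complex.I * ((inner ℝ (x - y) ξ : ℝ) : ℂ)) * b ξ := by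
  rw [Real.fourier_eq']
  congr 1 with ξ
  rw [smul_eq_mul]
  congr 2
  rw [inner_smul_right, mul_comm Complex.I]
  congr 2
  have : inner ℝ ξ (y - x) = - inner ℝ (x - y) ξ := by
    rw [real_inner_comm, ← inner_neg_left, neg_sub]
  rw [this]
  field_simp

theorem exists_norm_fourier_dyadic_scaled_le (n : ℕ) (m : ℝ) (C : ℕ → ℝ) (M : ℕ) :
    ∃ K : ℝ, 0 ≤ K ∧ ∀ p : Rn n → ℂ, SymbolBound m C p → ∀ (j : ℕ) (z : Rn n),
      ‖𝓕 (fun ξ => dyadic n j ξ * p ξ) ((2 * Real.pi)⁻¹ • z)‖ * (1 + 2 ^ j * ‖z‖) ^ M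
        ≤ K * ((2 : ℝ) ^ j) ^ (n + m) := by
  obtain ⟨K, hK0, hK⟩ := SymbolBound.exists_norm_fourier_dyadic_le n m C M
  refine ⟨(2 * Real.pi) ^ M * K, by positivity, fun p hp j z => ?_⟩
  have h := hK p hp j ((2 * Real.pi)⁻¹ • z)
  have hpi : (1 : ℝ) ≤ 2 * Real.pi := by nlinarith [Real.pi_gt_three]
  have h2 : 1 + 2 ^ j * ‖z‖ ≤ 2 * Real.pi * (1 + 2 ^ j * ‖(2 * Real.pi)⁻¹ • z‖) := by
    rw [norm_smul, Real.norm_of_nonneg (by positivity)]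
    have : 2 * Real.pi * (1 + 2 ^ j * ((2 * Real.pi)⁻¹ * ‖z‖)) = 2 * Real.pi + 2 ^ j * ‖z‖ := by
      field_simp
    rw [this]
    linarith
  calc _ ≤ ‖𝓕 (fun ξ => dyadic n j ξ * p ξ) ((2 * Real.pi)⁻¹ • z)‖ *
        (2 * Real.pi * (1 + 2 ^ j * ‖(2 * Real.pi)⁻¹ • z‖)) ^ M := by gcongr
    _ = (2 * Real.pi) ^ M * (‖𝓕 (fun ξ => dyadic n j ξ * p ξ) ((2 * Real.pi)⁻¹ • z)‖ *
        (1 + 2 ^ j * ‖(2 * Real.pi)⁻¹ • z‖) ^ M) := by rw [mul_pow]; ring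
    _ ≤ (2 * Real.pi) ^ M * (K * ((2 : ℝ) ^ j) ^ (n + m)) := by gcongr
    _ = _ := by ring

/-- Only the size of `p` on the shell matters, not its derivatives. This is essential for the
composed kernels, where `p` is itself an integral known only through such a bound. -/
theorem exists_integral_norm_dyadic_mul_le (n : ℕ) (m : ℝ) :
    ∃ K : ℝ, 0 ≤ K ∧ ∀ (p : Rn n → ℂ) (B : ℝ) (j : ℕ), 0 ≤ B →
      (∀ ξ ∈ tsupport (dyadic n j), ‖p ξ‖ ≤ B * (1 + ‖ξ‖ ^ 2) ^ (m / 2)) →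
      ∫ ξ, ‖dyadic n j ξ * p ξ‖ ≤ K * B * ((2 : ℝ) ^ j) ^ (n + m) := by
  obtain ⟨K, hK0, hK⟩ := exists_integral_norm_le_of_dyadic n m
  obtain ⟨D, hD⟩ := exists_symbolBound_dyadic n
  have hD0 := (hD 0).nonneg 0
  refine ⟨K * D 0, by positivity, fun p B j hB hp => ?_⟩
  rw [mul_assoc K]
  refine hK (fun ξ => dyadic n j ξ * p ξ) (D 0 * B) j (by positivity) (fun ξ hξ => ?_)
    (fun ξ hξ => ?_)
  · rw [image_eq_zero_of_notMem_tsupport hξ, zero_mul]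
  · rw [norm_mul, mul_assoc]
    have := (hD j).norm_le ξ
    rw [zero_div, Real.rpow_zero, mul_one] at this
    gcongr
    exact hp ξ hξ

theorem exists_nat_interpolate (N : ℕ) {τ τ' : ℝ} (hτ' : 0 < τ') (h : τ' < τ) :
    ∃ M : ℕ, N + τ' ≤ M * (1 - τ' / τ) := by
  have h1 : 0 < 1 - τ' / τ := by
    rw [sub_pos, div_lt_one (hτ'.trans h)]; exact h
  obtain ⟨M, hM⟩ := exists_nat_ge ((N + τ') / (1 - τ' / τ))
  exact ⟨M, (div_le_iff₀ h1).1 hM⟩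

/-- A symbol of size `|z|^τ` has dyadic kernels of size `2^{j (m - τ')}` at `z`, for `τ' < τ`. -/
theorem exists_norm_fourier_dyadic_le_dyadicWeight (n : ℕ) (m : ℝ) (C : ℕ → ℝ) (A : ℝ) (hA : 0 ≤ A)
    {τ τ' : ℝ} (hτ' : 0 < τ') (hττ' : τ' < τ) :
    ∃ K : ℝ, 0 ≤ K ∧ ∀ (p : Rn n → ℂ) (z : Rn n), SymbolBound m C p →
      (∀ ξ, ‖p ξ‖ ≤ A * ‖z‖ ^ τ * (1 + ‖ξ‖ ^ 2) ^ (m / 2)) → ∀ j : ℕ,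
      ‖𝓕 (fun ξ => dyadic n j ξ * p ξ) ((2 * Real.pi)⁻¹ • z)‖
        ≤ K * ((2 : ℝ) ^ j) ^ (m - τ') * dyadicWeight n j z := by
  obtain ⟨M, hM⟩ := exists_nat_interpolate (n + 1) hτ' hττ'
  obtain ⟨K₁, hK₁, h₁⟩ := exists_norm_fourier_dyadic_scaled_le n m C M
  obtain ⟨K₂, hK₂, h₂⟩ := exists_integral_norm_dyadic_mul_le n m
  refine ⟨K₁ + K₂ * A, by positivity, fun p z hp hpz j => ?_⟩
  have hτ : 0 < τ := hτ'.trans hττ'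
  have a₁ := h₁ p hp j z
  have a₂ := (norm_fourier_le_integral_norm (fun ξ => dyadic n j ξ * p ξ)
    ((2 * Real.pi)⁻¹ • z)).trans (h₂ p _ j (by positivity) fun ξ _ => hpz ξ)
  have hQ : 0 < ((2 : ℝ) ^ j) ^ (n + m) := by positivity
  -- At scale `ρ = 2^{-j}` with `r = 2^j ‖z‖` one has `‖z‖ ≤ ρ (1 + r)`, so the size bound and the
  -- decay bound fit the interpolation with the common factor `2^{j(n+m)}`. The weight exponent `n +
  -- 1` is the one in `dyadicWeight`.
  have key := mul_pow_le_of_interpolate (K := ‖𝓕 (fun ξ => dyadic n j ξ * p ξ)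
    ((2 * Real.pi)⁻¹ • z)‖) (A := (K₁ + K₂ * A) * ((2 : ℝ) ^ j) ^ (n + m)) (ρ := ((2 : ℝ) ^ j)⁻¹)
    (r := 2 ^ j * ‖z‖) (norm_nonneg _) (by positivity) (by positivity) hτ' hττ' hM ?_ ?_
  · apply le_mul_dyadicWeight
    refine key.trans_eq ?_
    rw [Real.inv_rpow (by positivity), ← Real.rpow_neg (by positivity), mul_assoc,
      ← Real.rpow_add (by positivity)]
    congr 2
    ring
  · refine a₂.trans ?_
    have hz : ‖z‖ ≤ ((2 : ℝ) ^ j)⁻¹ * (1 + 2 ^ j * ‖z‖) := by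
      rw [mul_add, inv_mul_cancel_left₀ (by positivity)]
      have : 0 < ((2 : ℝ) ^ j)⁻¹ := by positivity
      linarith
    calc K₂ * (A * ‖z‖ ^ τ) * ((2 : ℝ) ^ j) ^ (n + m)
        = (K₂ * A) * ((2 : ℝ) ^ j) ^ (n + m) * ‖z‖ ^ τ := by ring
      _ ≤ (K₁ + K₂ * A) * ((2 : ℝ) ^ j) ^ (n + m) *
          (((2 : ℝ) ^ j)⁻¹ * (1 + 2 ^ j * ‖z‖)) ^ τ := by
        gcongr
        linarith
  · refine a₁.trans ?_
    gcongr
    have : 0 ≤ K₂ * A := by positivity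
    linarith

/-! ### Kernels of the dyadic pieces of the Bessel potential -/

/-- The `l`-th dyadic piece of the symbol `⟨ξ⟩^s`. -/
noncomputable def besselPiece (n : ℕ) (s : ℝ) (l : ℕ) : 𝓢(Rn n, ℂ) :=
  HasCompactSupport.toSchwartzMap
    (f := fun ξ => dyadic n l ξ * (((1 + ‖ξ‖ ^ 2) ^ (s / 2) : ℝ) : ℂ))
    (hasCompactSupport_dyadic n l).mul_right
    (((exists_symbolBound_dyadic n).choose_spec l).contDiff.mul
      (exists_symbolBound_bessel n s).choose_spec.contDiff)

theorem coe_besselPiece (n : ℕ) (s : ℝ) (l : ℕ) : ⇑(besselPiece n s l) =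
    fun ξ => dyadic n l ξ * (((1 + ‖ξ‖ ^ 2) ^ (s / 2) : ℝ) : ℂ) := rfl

theorem exists_norm_fourier_besselPiece_le (n : ℕ) (s : ℝ) (M : ℕ) :
    ∃ K : ℝ, 0 ≤ K ∧ ∀ (l : ℕ) (t : Rn n),
      ‖𝓕 (besselPiece n s l) t‖ * (1 + 2 ^ l * ‖t‖) ^ M ≤ K * ((2 : ℝ) ^ l) ^ (n + s) := by
  obtain ⟨C, hC⟩ := exists_symbolBound_bessel n s
  obtain ⟨K, hK0, hK⟩ := SymbolBound.exists_norm_fourier_dyadic_le n s C M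
  exact ⟨K, hK0, fun l t => hK _ hC l t⟩

theorem exists_integral_fourier_besselPiece_le (n : ℕ) (s : ℝ) (N : ℕ) :
    ∃ K : ℝ, 0 ≤ K ∧ ∀ l : ℕ,
      Integrable (fun t => ‖𝓕 (besselPiece n s l) t‖ * (1 + 2 ^ l * ‖t‖) ^ N) ∧
      ∫ t, ‖𝓕 (besselPiece n s l) t‖ * (1 + 2 ^ l * ‖t‖) ^ N ≤ K * ((2 : ℝ) ^ l) ^ s := by
  obtain ⟨K, hK0, hK⟩ := exists_norm_fourier_besselPiece_le n s (N + (n + 1))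
  have hle (l : ℕ) (t : Rn n) : ‖𝓕 (besselPiece n s l) t‖ * (1 + 2 ^ l * ‖t‖) ^ N
      ≤ K * ((2 : ℝ) ^ l) ^ s * dyadicWeight n l t := by
    apply le_mul_dyadicWeight
    rw [mul_assoc, ← pow_add]
    exact hK l t
  have hInt (l : ℕ) := (integrable_dyadicWeight n l).const_mul (K * ((2 : ℝ) ^ l) ^ s)
  have hi (l : ℕ) : Integrable (fun t => ‖𝓕 (besselPiece n s l) t‖ * (1 + 2 ^ l * ‖t‖) ^ N) := by
    refine (hInt l).mono' ?_ (Eventually.of_forall fun t => ?_)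
    · exact ((𝓕 (besselPiece n s l)).continuous.norm.mul (by fun_prop)).aestronglyMeasurable
    · rw [Real.norm_of_nonneg (by positivity)]
      exact hle l t
  refine ⟨K * ∫ z : Rn n, ((1 + ‖z‖) ^ (n + 1))⁻¹,
    mul_nonneg hK0 (integral_nonneg fun _ => by positivity), fun l => ⟨hi l, ?_⟩⟩
  refine (integral_mono (hi l) (hInt l) (hle l)).trans_eq ?_
  rw [integral_const_mul, integral_dyadicWeight]
  ring

/-- The kernel of the `l`-th piece lives at distance `2^{-l}`, so a factor `‖t‖ ^ τ` gains
`2^{-lτ}`. -/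
theorem exists_integral_fourier_besselPiece_rpow_le (n : ℕ) (s : ℝ) {τ : ℝ} (hτ : 0 < τ) :
    ∃ K : ℝ, 0 ≤ K ∧ ∀ l : ℕ,
      Integrable (fun t => ‖𝓕 (besselPiece n s l) t‖ * ‖t‖ ^ τ) ∧
      ∫ t, ‖𝓕 (besselPiece n s l) t‖ * ‖t‖ ^ τ ≤ K * ((2 : ℝ) ^ l) ^ (s - τ) := by
  obtain ⟨K, hK0, hK⟩ := exists_integral_fourier_besselPiece_le n s ⌈τ⌉₊
  have hle (l : ℕ) (t : Rn n) : ‖𝓕 (besselPiece n s l) t‖ * ‖t‖ ^ τ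
      ≤ ((2 : ℝ) ^ l) ^ (-τ) * (‖𝓕 (besselPiece n s l) t‖ * (1 + 2 ^ l * ‖t‖) ^ ⌈τ⌉₊) := by
    have h1 : ‖t‖ ^ τ = ((2 : ℝ) ^ l) ^ (-τ) * (2 ^ l * ‖t‖) ^ τ := by
      rw [Real.mul_rpow (by positivity) (by positivity), ← mul_assoc,
        ← Real.rpow_add (by positivity), neg_add_cancel, Real.rpow_zero, one_mul]
    have h2 : (2 ^ l * ‖t‖) ^ τ ≤ (1 + 2 ^ l * ‖t‖) ^ ⌈τ⌉₊ := by
      have h0 : 0 ≤ 2 ^ l * ‖t‖ := by positivity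
      rw [← Real.rpow_natCast (1 + 2 ^ l * ‖t‖)]
      calc (2 ^ l * ‖t‖) ^ τ ≤ (1 + 2 ^ l * ‖t‖) ^ τ := by gcongr; linarith
        _ ≤ _ := Real.rpow_le_rpow_of_exponent_le (by linarith) (Nat.le_ceil τ)
    rw [h1]
    calc _ = ((2 : ℝ) ^ l) ^ (-τ) * (‖𝓕 (besselPiece n s l) t‖ * (2 ^ l * ‖t‖) ^ τ) := by ring
      _ ≤ _ := by gcongr
  have hi (l : ℕ) : Integrable (fun t => ‖𝓕 (besselPiece n s l) t‖ * ‖t‖ ^ τ) := by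
    refine ((hK l).1.const_mul (((2 : ℝ) ^ l) ^ (-τ))).mono' ?_ (Eventually.of_forall fun t => ?_)
    · exact ((𝓕 (besselPiece n s l)).continuous.norm.mul
        (continuous_norm.rpow_const fun _ => Or.inr hτ.le)).aestronglyMeasurable
    · rw [Real.norm_of_nonneg (by positivity)]
      exact hle l t
  refine ⟨K, hK0, fun l => ⟨hi l, ?_⟩⟩
  refine (integral_mono (hi l) ((hK l).1.const_mul _) (hle l)).trans ?_
  rw [integral_const_mul]
  calc _ ≤ ((2 : ℝ) ^ l) ^ (-τ) * (K * ((2 : ℝ) ^ l) ^ s) := by gcongr; exact (hK l).2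
    _ = K * (((2 : ℝ) ^ l) ^ s * ((2 : ℝ) ^ l) ^ (-τ)) := by ring
    _ = _ := by rw [← Real.rpow_add (by positivity), ← sub_eq_add_neg]

/-! ### Vanishing moments -/

theorem SchwartzMap.fourier_fourier_apply {n : ℕ} (ψ : 𝓢(Rn n, ℂ)) (x : Rn n) :
    𝓕 (⇑(𝓕 ψ : 𝓢(Rn n, ℂ))) x = ψ (-x) := by
  have h1 : 𝓕⁻ (𝓕 ψ) = ψ := FourierTransform.fourierInv_fourier_eq ψ
  have h2 : 𝓕⁻ (⇑(𝓕 ψ : 𝓢(Rn n, ℂ))) (-x) = ψ (-x) := by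
    rw [← SchwartzMap.fourierInv_coe, h1]
  rw [← h2, Real.fourierInv_eq_fourier_neg, neg_neg]

theorem SchwartzMap.integrable_fourier_mul_prod {n : ℕ} (ψ : 𝓢(Rn n, ℂ)) (ξ : Rn n) {i : ℕ}
    (v : Fin i → Rn n) :
    Integrable (fun t => 𝓕 ψ t * Complex.exp (Complex.I * ((inner ℝ t ξ : ℝ) : ℂ))
      * ∏ k, ((inner ℝ t (v k) : ℝ) : ℂ)) := by
  refine (((𝓕 ψ).integrable_pow_mul volume i).mul_const (∏ k, ‖v k‖)).mono' ?_
    (Eventually.of_forall fun t => ?_)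
  · refine Continuous.aestronglyMeasurable ?_
    have := (𝓕 ψ).continuous
    fun_prop
  · rw [norm_mul, norm_mul, mul_comm Complex.I, Complex.norm_exp_ofReal_mul_I, mul_one, norm_prod]
    have : ∏ k, ‖((inner ℝ t (v k) : ℝ) : ℂ)‖ ≤ ‖t‖ ^ i * ∏ k, ‖v k‖ := by
      calc _ ≤ ∏ k : Fin i, (‖t‖ * ‖v k‖) := by
            refine Finset.prod_le_prod (fun _ _ => norm_nonneg _) fun k _ => ?_
            rw [Complex.norm_real]
            exact norm_inner_le_norm _ _
        _ = _ := by rw [Finset.prod_mul_distrib]; simp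
    calc _ ≤ ‖𝓕 ψ t‖ * (‖t‖ ^ i * ∏ k, ‖v k‖) := by gcongr
      _ = _ := by ring

/-- Up to a nonzero constant these moments are the derivatives of `𝓕 (𝓕 ψ) = ψ(-·)` at `η = -ξ /
2π`, and that function vanishes in a neighbourhood of `η`. -/
theorem SchwartzMap.integral_fourier_mul_prod_eq_zero {n : ℕ} (ψ : 𝓢(Rn n, ℂ)) {ξ : Rn n}
    (h : (2 * Real.pi)⁻¹ • ξ ∉ tsupport ψ) {i : ℕ} (v : Fin i → Rn n) :
    ∫ t, 𝓕 ψ t * Complex.exp (Complex.I * ((inner ℝ t ξ : ℝ) : ℂ))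
      * ∏ k, ((inner ℝ t (v k) : ℝ) : ℂ) = 0 := by
  set η : Rn n := -((2 * Real.pi)⁻¹ • ξ) with hη
  have hInt (k : ℕ) : Integrable (fun t => ‖t‖ ^ k * ‖𝓕 ψ t‖) := (𝓕 ψ).integrable_pow_mul volume k
  have h1 := congrFun (Real.iteratedFDeriv_fourier (N := ⊤) (f := ⇑(𝓕 ψ : 𝓢(Rn n, ℂ))) (fun k _ => hInt k)
    (𝓕 ψ).continuous.aestronglyMeasurable (n := i) (mod_cast le_top)) η
  have h0 : iteratedFDeriv ℝ i (𝓕 (⇑(𝓕 ψ : 𝓢(Rn n, ℂ)))) η = 0 := by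
    have he : 𝓕 (⇑(𝓕 ψ : 𝓢(Rn n, ℂ))) =ᶠ[𝓝 η] fun _ => 0 := by
      have hc : ∀ᶠ x in 𝓝 η, -x ∉ tsupport ψ := by
        refine (continuous_neg.tendsto η).eventually
          ((isClosed_tsupport ψ).isOpen_compl.mem_nhds ?_)
        simpa [hη] using h
      filter_upwards [hc] with x hx
      rw [SchwartzMap.fourier_fourier_apply, image_eq_zero_of_notMem_tsupport hx]
    rw [(Filter.EventuallyEq.iteratedFDeriv ℝ he i).eq_of_nhds]
    simp [iteratedFDeriv_fun_zero]
  rw [h0, Real.fourier_eq] at h1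
  have hI : Integrable (fun t => Real.fourierChar (-inner ℝ t η) •
      VectorFourier.fourierPowSMulRight (innerSL ℝ) (⇑(𝓕 ψ : 𝓢(Rn n, ℂ))) t i) :=
    (Real.fourierIntegral_convergent_iff η).2
      (VectorFourier.integrable_fourierPowSMulRight (innerSL ℝ) (hInt i)
        (𝓕 ψ).continuous.aestronglyMeasurable)
  have h2 := congrArg (fun T => T v) h1
  simp only [ContinuousMultilinearMap.integral_apply hI] at h2
  have hc : ((-(2 * Real.pi * Complex.I)) ^ i : ℂ) ≠ 0 :=
    pow_ne_zero _ (neg_ne_zero.2 (by simp [Real.pi_ne_zero]))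
  have h3 : ∫ t, (-(2 * Real.pi * Complex.I)) ^ i * (𝓕 ψ t *
      Complex.exp (Complex.I * ((inner ℝ t ξ : ℝ) : ℂ)) * ∏ k, ((inner ℝ t (v k) : ℝ) : ℂ)) = 0 := by
    refine Eq.trans ?_ h2.symm
    congr 1 with t
    have e : Complex.exp (Complex.I * ((inner ℝ t ξ : ℝ) : ℂ))
        = (Real.fourierChar (-inner ℝ t η) : ℂ) := by
      rw [Real.fourierChar_apply, hη, inner_neg_right, neg_neg, inner_smul_right, mul_comm Complex.I]
      congr 2
      norm_cast
      field_simp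
    rw [e]
    simp only [Circle.smul_def, smul_apply, VectorFourier.fourierPowSMulRight_apply, smul_eq_mul,
      Complex.real_smul, Complex.ofReal_prod]
    change _ = _ * (_ * ((∏ k, ((inner ℝ t (v k) : ℝ) : ℂ)) * _))
    ring
  rw [integral_const_mul] at h3
  exact (mul_eq_zero.1 h3).resolve_left hc

theorem ContinuousMultilinearMap.apply_diag_eq_sum {n i : ℕ} {F : Type*} [NormedAddCommGroup F]
    [NormedSpace ℝ F] (D : ContinuousMultilinearMap ℝ (fun _ : Fin i => Rn n) F) (t : Rn n) :
    D (fun _ => t) = ∑ r : Fin i → Fin n, (∏ k, inner ℝ t (EuclideanSpace.basisFun (Fin n) ℝ (r k)))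
      • D (fun k => EuclideanSpace.basisFun (Fin n) ℝ (r k)) := by
  have ht : t = ∑ l, inner ℝ t (EuclideanSpace.basisFun (Fin n) ℝ l) •
      EuclideanSpace.basisFun (Fin n) ℝ l := by
    conv_lhs => rw [← (EuclideanSpace.basisFun (Fin n) ℝ).sum_repr' t]
    simp_rw [real_inner_comm]
  conv_lhs => rw [ht]
  rw [D.map_sum (fun _ l => inner ℝ t (EuclideanSpace.basisFun (Fin n) ℝ l) •
      EuclideanSpace.basisFun (Fin n) ℝ l)]
  refine Finset.sum_congr rfl fun r _ => ?_
  exact D.map_smul_univ (fun k => inner ℝ t (EuclideanSpace.basisFun (Fin n) ℝ (r k)))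
    (fun k => EuclideanSpace.basisFun (Fin n) ℝ (r k))

/-- All moments of `𝓕 ψ · e^{i⟨·,ξ⟩}` vanish when `ψ` vanishes near `ξ / 2π`. -/
theorem SchwartzMap.integral_fourier_mul_multilinear_eq_zero {n : ℕ} (ψ : 𝓢(Rn n, ℂ)) {ξ : Rn n}
    (h : (2 * Real.pi)⁻¹ • ξ ∉ tsupport ψ) {i : ℕ}
    (D : ContinuousMultilinearMap ℝ (fun _ : Fin i => Rn n) ℂ) :
    Integrable (fun t => 𝓕 ψ t * Complex.exp (Complex.I * ((inner ℝ t ξ : ℝ) : ℂ))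
      * D (fun _ => t)) ∧
    ∫ t, 𝓕 ψ t * Complex.exp (Complex.I * ((inner ℝ t ξ : ℝ) : ℂ)) * D (fun _ => t) = 0 := by
  have e (t : Rn n) : 𝓕 ψ t * Complex.exp (Complex.I * ((inner ℝ t ξ : ℝ) : ℂ)) * D (fun _ => t)
      = ∑ r : Fin i → Fin n, 𝓕 ψ t * Complex.exp (Complex.I * ((inner ℝ t ξ : ℝ) : ℂ))
        * (∏ k, ((inner ℝ t (EuclideanSpace.basisFun (Fin n) ℝ (r k)) : ℝ) : ℂ))
        * D (fun k => EuclideanSpace.basisFun (Fin n) ℝ (r k)) := by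
    rw [D.apply_diag_eq_sum, Finset.mul_sum]
    refine Finset.sum_congr rfl fun r _ => ?_
    rw [Complex.real_smul, Complex.ofReal_prod]
    ring
  simp_rw [e]
  have hi (r : Fin i → Fin n) := (ψ.integrable_fourier_mul_prod ξ
    (fun k => EuclideanSpace.basisFun (Fin n) ℝ (r k))).mul_const
      (D (fun k => EuclideanSpace.basisFun (Fin n) ℝ (r k)))
  refine ⟨integrable_finsetSum _ fun r _ => hi r, ?_⟩
  rw [integral_finsetSum _ fun r _ => hi r]
  refine Finset.sum_eq_zero fun r _ => ?_
  rw [integral_mul_const, ψ.integral_fourier_mul_prod_eq_zero h, zero_mul]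

/-- Neighbouring shells overlap, but the Bessel multiplier is expressed in the frequency variable of
`𝓕`, which is `ξ / 2π`. Since `2π > 2`, this rescaling separates the supports as soon as `j < l`. -/
theorem notMem_tsupport_besselPiece {n j l : ℕ} (hjl : j < l) (s : ℝ) {ξ : Rn n}
    (h : ξ ∈ tsupport (dyadic n j)) : (2 * Real.pi)⁻¹ • ξ ∉ tsupport (besselPiece n s l) := by
  intro h'
  have h1 : (2 * Real.pi)⁻¹ • ξ ∈ tsupport (dyadic n l) := tsupport_mul_subset_left h'
  obtain ⟨l, rfl⟩ : ∃ k, l = k + 1 := ⟨l - 1, by omega⟩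
  have h2 := le_norm_of_mem_tsupport_dyadic_succ h1
  have h3 := tsupport_dyadic_subset_closedBall n j h
  rw [mem_closedBall_zero_iff, pow_succ] at h3
  rw [norm_smul, Real.norm_of_nonneg (by positivity), ← div_eq_inv_mul,
    le_div_iff₀ (by positivity)] at h2
  have h4 : (2 : ℝ) ^ j ≤ 2 ^ l := pow_le_pow_right₀ one_le_two (by omega)
  have h5 : (0 : ℝ) < 2 ^ l := by positivity
  nlinarith [Real.pi_gt_three]

/-! ### The dyadic pieces of the kernel of `op(a)` -/

/-- The kernel of the operator with symbol `a(x, y, ξ)` cut off to `|ξ| ∼ 2^j`. -/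
noncomputable def dyadicKernel {n : ℕ} (a : Rn n × Rn n → Rn n → ℂ) (j : ℕ) (x y : Rn n) : ℂ :=
  ((2 * (Real.pi : ℂ)) ^ n)⁻¹ *
    𝓕 (fun ξ => dyadic n j ξ * a (x, y) ξ) ((2 * Real.pi)⁻¹ • (y - x))

theorem dyadicKernel_eq_integral {n : ℕ} (a : Rn n × Rn n → Rn n → ℂ) (j : ℕ) (x y : Rn n) :
    dyadicKernel a j x y = ((2 * (Real.pi : ℂ)) ^ n)⁻¹ *
      ∫ ξ, Complex.exp (Complex.I * ((inner ℝ (x - y) ξ : ℝ) : ℂ)) *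
        (dyadic n j ξ * a (x, y) ξ) := by
  rw [dyadicKernel, fourier_two_pi_inv_smul]

theorem norm_two_pi_pow_inv_le_one (n : ℕ) : ‖((2 * (Real.pi : ℂ)) ^ n)⁻¹‖ ≤ 1 := by
  rw [norm_inv, norm_pow]
  refine inv_le_one_of_one_le₀ (one_le_pow₀ ?_)
  simp only [Complex.norm_mul, Complex.norm_ofNat, Complex.norm_real, Real.norm_eq_abs,
    abs_of_pos Real.pi_pos]
  nlinarith [Real.pi_gt_three]

theorem norm_cexp_I_mul_ofReal (t : ℝ) : ‖Complex.exp (Complex.I * (t : ℂ))‖ = 1 := by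
  rw [mul_comm, Complex.norm_exp_ofReal_mul_I]

theorem dyadicWeight_neg (n j : ℕ) (z : Rn n) : dyadicWeight n j (-z) = dyadicWeight n j z := by
  simp [dyadicWeight]

/-- The integrable majorant of the symbol cut off to `|ξ| ∼ 2^j`. -/
theorem integrable_dyadic_mul_bracket (n j : ℕ) (m C : ℝ) :
    Integrable (fun ξ : Rn n => ‖dyadic n j ξ‖ * (C * (1 + ‖ξ‖ ^ 2) ^ (m / 2))) := by
  refine Continuous.integrable_of_hasCompactSupport ?_ ?_
  · refine (continuous_dyadic n j).norm.mul (continuous_const.mul ?_)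
    exact Continuous.rpow_const (by fun_prop) fun ξ => Or.inl (by positivity)
  · exact (hasCompactSupport_dyadic n j).norm.mul_right

section Kernel

variable {n : ℕ} {τ m : ℝ} {a : Rn n × Rn n → Rn n → ℂ}

theorem continuous_dyadicKernel (ha : IsHolderSymbol τ m a) (j : ℕ) :
    Continuous (fun z : Rn n × Rn n => dyadicKernel a j z.1 z.2) := by
  obtain ⟨C, hC⟩ := ha.exists_symbolBound
  simp_rw [dyadicKernel_eq_integral]
  refine continuous_const.mul ?_
  refine continuous_of_dominated (fun z => ?_) (fun z => Eventually.of_forall fun ξ => ?_)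
    (integrable_dyadic_mul_bracket n j m (C 0)) (Eventually.of_forall fun ξ => ?_)
  · refine Continuous.aestronglyMeasurable ?_
    have h1 := (ha.smooth z).continuous
    have h2 := continuous_dyadic n j
    fun_prop
  · rw [norm_mul, norm_cexp_I_mul_ofReal, one_mul, norm_mul]
    gcongr
    exact (hC z).norm_le ξ
  · have h1 : Continuous (fun z : Rn n × Rn n => a z ξ) :=
      ha.continuous.comp (continuous_id.prodMk continuous_const)
    fun_prop

/-- Taylor's formula at `(x, x)` in the direction `(0, y - x)`: by the diagonal condition every term
of the polynomial vanishes. -/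
theorem IsHolderSymbol.exists_norm_le_of_diag (hτ : 0 < τ) (ha : IsHolderSymbol τ m a)
    (hdiag : ∀ x ξ : Rn n, ∀ j : ℕ, (j : ℝ) < τ →
      iteratedFDeriv ℝ j (fun X : Rn n × Rn n => a X ξ) (x, x) = 0) :
    ∃ A : ℝ, 0 ≤ A ∧ ∀ x y ξ,
      ‖a (x, y) ξ‖ ≤ A * ‖y - x‖ ^ τ * (1 + ‖ξ‖ ^ 2) ^ (m / 2) := by
  obtain ⟨C, hC0, hC⟩ := ha.exists_hasHolderBound
  refine ⟨3 * C, by positivity, fun x y ξ => ?_⟩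
  have := (hC ξ).norm_le_of_iteratedFDeriv_eq_zero hτ (x, x) (0, y - x) (hdiag x ξ)
  have e : ((x, x) : Rn n × Rn n) + (0, y - x) = (x, y) := by ext1 <;> simp
  have e2 : ‖((0 : Rn n), y - x)‖ = ‖y - x‖ := by simp [Prod.norm_def]
  rw [e, e2] at this
  refine this.trans_eq ?_
  ring

theorem exists_norm_dyadicKernel_le {τ' : ℝ} (hτ' : 0 < τ') (hττ' : τ' < τ)
    (ha : IsHolderSymbol τ m a)
    (hdiag : ∀ x ξ : Rn n, ∀ j : ℕ, (j : ℝ) < τ →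
      iteratedFDeriv ℝ j (fun X : Rn n × Rn n => a X ξ) (x, x) = 0) :
    ∃ K : ℝ, 0 ≤ K ∧ ∀ (j : ℕ) (x y : Rn n), ‖dyadicKernel a j x y‖
      ≤ K * ((2 : ℝ) ^ j) ^ (m - τ') * dyadicWeight n j (x - y) := by
  obtain ⟨A, hA, hle⟩ := ha.exists_norm_le_of_diag (hτ'.trans hττ') hdiag
  obtain ⟨C, hC⟩ := ha.exists_symbolBound
  obtain ⟨K, hK0, hK⟩ := exists_norm_fourier_dyadic_le_dyadicWeight n m C A hA hτ' hττ'
  refine ⟨K, hK0, fun j x y => ?_⟩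
  rw [dyadicKernel, norm_mul, ← dyadicWeight_neg, neg_sub]
  refine (mul_le_of_le_one_left (norm_nonneg _) (norm_two_pi_pow_inv_le_one n)).trans ?_
  exact hK _ _ (hC (x, y)) (hle x y) j

theorem exists_norm_dyadicKernel_mul_pow_le (ha : IsHolderSymbol τ m a) (M : ℕ) :
    ∃ K : ℝ, 0 ≤ K ∧ ∀ (j : ℕ) (x y : Rn n),
      ‖dyadicKernel a j x y‖ * (1 + 2 ^ j * ‖x - y‖) ^ M ≤ K * ((2 : ℝ) ^ j) ^ (n + m) := by
  obtain ⟨C, hC⟩ := ha.exists_symbolBound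
  obtain ⟨K, hK0, hK⟩ := exists_norm_fourier_dyadic_scaled_le n m C M
  refine ⟨K, hK0, fun j x y => ?_⟩
  rw [dyadicKernel, norm_mul, norm_sub_rev x y, mul_assoc]
  refine (mul_le_of_le_one_left (by positivity) (norm_two_pi_pow_inv_le_one n)).trans ?_
  exact hK _ (hC (x, y)) j (y - x)

/-! ### Kernels composed with the pieces of the Bessel potential. -/

/-- The kernel of the `l`-th piece of the Bessel potential composed with the operator with kernel
`dyadicKernel a j`. -/
noncomputable def composedKernel (a : Rn n × Rn n → Rn n → ℂ) (s : ℝ) (j l : ℕ) (z y : Rn n) : ℂ :=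
  ∫ t, 𝓕 (besselPiece n s l) t * dyadicKernel a j (z + t) y

theorem norm_composedKernel_le (a : Rn n × Rn n → Rn n → ℂ) (s : ℝ) (j l : ℕ) (z y : Rn n) :
    ‖composedKernel a s j l z y‖
      ≤ ∫ t, ‖𝓕 (besselPiece n s l) t‖ * ‖dyadicKernel a j (z + t) y‖ := by
  refine (norm_integral_le_integral_norm _).trans_eq ?_
  simp_rw [norm_mul]

/-- Averaging at the finer scale `2^{-l} ≤ 2^{-j}` does not spoil decay at scale `2^{-j}`, because
`1 + 2^j‖z - y‖ ≤ (1 + 2^j‖z + t - y‖)(1 + 2^l‖t‖)`. -/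
theorem exists_norm_composedKernel_mul_pow_le (ha : IsHolderSymbol τ m a) (s : ℝ) (M : ℕ) :
    ∃ K : ℝ, 0 ≤ K ∧ ∀ (j l : ℕ) (z y : Rn n), j ≤ l →
      ‖composedKernel a s j l z y‖ * (1 + 2 ^ j * ‖z - y‖) ^ M
        ≤ K * ((2 : ℝ) ^ l) ^ s * ((2 : ℝ) ^ j) ^ (n + m) := by
  obtain ⟨K₁, hK₁0, hK₁⟩ := exists_norm_dyadicKernel_mul_pow_le ha M
  obtain ⟨K₂, hK₂0, hK₂⟩ := exists_integral_fourier_besselPiece_le n s M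
  refine ⟨K₁ * K₂, by positivity, fun j l z y hjl => ?_⟩
  have hpt (t : Rn n) : (1 + 2 ^ j * ‖z - y‖) ^ M *
      (‖𝓕 (besselPiece n s l) t‖ * ‖dyadicKernel a j (z + t) y‖)
      ≤ K₁ * ((2 : ℝ) ^ j) ^ (n + m) *
        (‖𝓕 (besselPiece n s l) t‖ * (1 + 2 ^ l * ‖t‖) ^ M) := by
    have h2 : (2 : ℝ) ^ j ≤ 2 ^ l := pow_le_pow_right₀ one_le_two hjl
    have h1 : 1 + 2 ^ j * ‖z - y‖ ≤ (1 + 2 ^ j * ‖z + t - y‖) * (1 + 2 ^ l * ‖t‖) := by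
      have h3 : ‖z - y‖ ≤ ‖z + t - y‖ + ‖t‖ := by
        calc ‖z - y‖ = ‖(z + t - y) - t‖ := by congr 1; abel
          _ ≤ _ := norm_sub_le _ _
      have h4 : 2 ^ j * ‖z - y‖ ≤ 2 ^ j * ‖z + t - y‖ + 2 ^ l * ‖t‖ := by
        calc 2 ^ j * ‖z - y‖ ≤ 2 ^ j * (‖z + t - y‖ + ‖t‖) := by gcongr
          _ = 2 ^ j * ‖z + t - y‖ + 2 ^ j * ‖t‖ := by ring
          _ ≤ _ := by gcongr
      have h5 : 0 ≤ 2 ^ j * ‖z + t - y‖ * (2 ^ l * ‖t‖) := by positivity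
      nlinarith
    calc _ ≤ ((1 + 2 ^ j * ‖z + t - y‖) * (1 + 2 ^ l * ‖t‖)) ^ M *
          (‖𝓕 (besselPiece n s l) t‖ * ‖dyadicKernel a j (z + t) y‖) := by gcongr
      _ = (‖dyadicKernel a j (z + t) y‖ * (1 + 2 ^ j * ‖z + t - y‖) ^ M) *
          (‖𝓕 (besselPiece n s l) t‖ * (1 + 2 ^ l * ‖t‖) ^ M) := by rw [mul_pow]; ring
      _ ≤ _ := mul_le_mul_of_nonneg_right (hK₁ j (z + t) y) (by positivity)
  calc _ ≤ (∫ t, ‖𝓕 (besselPiece n s l) t‖ * ‖dyadicKernel a j (z + t) y‖) *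
        (1 + 2 ^ j * ‖z - y‖) ^ M := by
        gcongr
        exact norm_composedKernel_le a s j l z y
    _ = ∫ t, (1 + 2 ^ j * ‖z - y‖) ^ M *
        (‖𝓕 (besselPiece n s l) t‖ * ‖dyadicKernel a j (z + t) y‖) := by
        rw [integral_const_mul, mul_comm]
    _ ≤ ∫ t, K₁ * ((2 : ℝ) ^ j) ^ (n + m) *
        (‖𝓕 (besselPiece n s l) t‖ * (1 + 2 ^ l * ‖t‖) ^ M) := by
        refine integral_mono_of_nonneg (Eventually.of_forall fun t => by positivity)
          ((hK₂ l).1.const_mul _) (Eventually.of_forall hpt)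
    _ ≤ K₁ * ((2 : ℝ) ^ j) ^ (n + m) * (K₂ * ((2 : ℝ) ^ l) ^ s) := by
        rw [integral_const_mul]
        gcongr
        exact (hK₂ l).2
    _ = _ := by ring

theorem integrable_fourier_besselPiece_mul_symbol (ha : IsHolderSymbol τ m a) (s : ℝ) (l : ℕ)
    (z y ξ : Rn n) :
    Integrable (fun t => 𝓕 (besselPiece n s l) t *
      Complex.exp (Complex.I * ((inner ℝ t ξ : ℝ) : ℂ)) * a (z + t, y) ξ) := by
  obtain ⟨C, hC⟩ := ha.exists_symbolBound
  refine ((𝓕 (besselPiece n s l)).integrable.norm.mul_const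
    (C 0 * (1 + ‖ξ‖ ^ 2) ^ (m / 2))).mono' ?_ (Eventually.of_forall fun t => ?_)
  · have h1 : Continuous (fun t : Rn n => a (z + t, y) ξ) :=
      ha.continuous.comp (by fun_prop : Continuous fun t : Rn n => (((z + t, y) : Rn n × Rn n), ξ))
    have h2 := (𝓕 (besselPiece n s l)).continuous
    exact ((h2.mul (by fun_prop)).mul h1).aestronglyMeasurable
  · rw [norm_mul, norm_mul, norm_cexp_I_mul_ofReal, mul_one]
    gcongr
    exact (hC _).norm_le ξ

/-- High frequency pieces of the Bessel potential only see the Hölder regularity of the symbol. -/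
theorem exists_norm_integral_besselPiece_mul_symbol_le (hτ : 0 < τ) (ha : IsHolderSymbol τ m a)
    (s : ℝ) :
    ∃ K : ℝ, 0 ≤ K ∧ ∀ (j l : ℕ) (z y ξ : Rn n), j < l → ξ ∈ tsupport (dyadic n j) →
      ‖∫ t, 𝓕 (besselPiece n s l) t *
        Complex.exp (Complex.I * ((inner ℝ t ξ : ℝ) : ℂ)) * a (z + t, y) ξ‖
      ≤ K * ((2 : ℝ) ^ l) ^ (s - τ) * (1 + ‖ξ‖ ^ 2) ^ (m / 2) := by
  obtain ⟨C, hC0, hC⟩ := ha.exists_hasHolderBound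
  obtain ⟨K, hK0, hK⟩ := exists_integral_fourier_besselPiece_rpow_le n s hτ
  refine ⟨3 * C * K, by positivity, fun j l z y ξ hjl hξ => ?_⟩
  set D : (i : ℕ) → ContinuousMultilinearMap ℝ (fun _ : Fin i => Rn n) ℂ := fun i =>
    (1 / i.factorial : ℝ) • (iteratedFDeriv ℝ i (fun X : Rn n × Rn n => a X ξ)
      (z, y)).compContinuousLinearMap fun _ => ContinuousLinearMap.inl ℝ (Rn n) (Rn n) with hD
  have hmom (i : ℕ) := (besselPiece n s l).integral_fourier_mul_multilinear_eq_zero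
    (notMem_tsupport_besselPiece hjl s hξ) (D i)
  have hrem (t : Rn n) : ‖a (z + t, y) ξ - ∑ i ∈ Finset.range ⌈τ⌉₊, D i (fun _ => t)‖
      ≤ 3 * (C * (1 + ‖ξ‖ ^ 2) ^ (m / 2)) * ‖t‖ ^ τ := by
    have := (hC ξ).norm_sub_taylor_le hτ (z, y) (t, 0)
    have e : ((z, y) : Rn n × Rn n) + (t, 0) = (z + t, y) := by ext1 <;> simp
    have e2 : ‖(t, (0 : Rn n))‖ = ‖t‖ := by simp [Prod.norm_def]
    rw [e, e2] at this
    simpa [hD] using this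
  -- Since all moments vanish, the Taylor polynomial of `a(·, y, ξ)` at `z` can be subtracted for
  -- free, leaving a remainder of size `‖t‖ ^ τ`.
  have e : ∫ t, 𝓕 (besselPiece n s l) t *
        Complex.exp (Complex.I * ((inner ℝ t ξ : ℝ) : ℂ)) * a (z + t, y) ξ
      = ∫ t, 𝓕 (besselPiece n s l) t * Complex.exp (Complex.I * ((inner ℝ t ξ : ℝ) : ℂ)) *
        (a (z + t, y) ξ - ∑ i ∈ Finset.range ⌈τ⌉₊, D i (fun _ => t)) := by
    simp_rw [mul_sub, Finset.mul_sum]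
    rw [integral_sub (integrable_fourier_besselPiece_mul_symbol ha s l z y ξ)
      (integrable_finsetSum _ fun i _ => (hmom i).1), integral_finsetSum _ fun i _ => (hmom i).1,
      Finset.sum_eq_zero fun i _ => (hmom i).2, sub_zero]
  rw [e]
  calc _ ≤ ∫ t, 3 * (C * (1 + ‖ξ‖ ^ 2) ^ (m / 2)) * (‖𝓕 (besselPiece n s l) t‖ * ‖t‖ ^ τ) := by
        refine norm_integral_le_of_norm_le ((hK l).1.const_mul _)
          (Eventually.of_forall fun t => ?_)
        rw [norm_mul, norm_mul, norm_cexp_I_mul_ofReal, mul_one]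
        calc _ ≤ ‖𝓕 (besselPiece n s l) t‖ * (3 * (C * (1 + ‖ξ‖ ^ 2) ^ (m / 2)) * ‖t‖ ^ τ) := by
              gcongr
              exact hrem t
          _ = _ := by ring
    _ ≤ 3 * (C * (1 + ‖ξ‖ ^ 2) ^ (m / 2)) * (K * ((2 : ℝ) ^ l) ^ (s - τ)) := by
        rw [integral_const_mul]
        gcongr
        exact (hK l).2
    _ = _ := by ring

/-- Fubini and the splitting `e^{i(z+t-y)·ξ} = e^{i(z-y)·ξ} e^{it·ξ}` isolate, at each fixed `ξ`,
the integral in `t` where the cancellation takes place. -/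
theorem composedKernel_eq_integral (ha : IsHolderSymbol τ m a) (s : ℝ) (j l : ℕ) (z y : Rn n) :
    composedKernel a s j l z y = ((2 * (Real.pi : ℂ)) ^ n)⁻¹ *
      ∫ ξ, dyadic n j ξ * (Complex.exp (Complex.I * ((inner ℝ (z - y) ξ : ℝ) : ℂ)) *
        ∫ t, 𝓕 (besselPiece n s l) t *
          Complex.exp (Complex.I * ((inner ℝ t ξ : ℝ) : ℂ)) * a (z + t, y) ξ) := by
  obtain ⟨C, hC⟩ := ha.exists_symbolBound
  set G : Rn n → Rn n → ℂ := fun t ξ => 𝓕 (besselPiece n s l) t *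
    (Complex.exp (Complex.I * ((inner ℝ (z + t - y) ξ : ℝ) : ℂ)) * (dyadic n j ξ * a (z + t, y) ξ))
  have hG : Integrable (Function.uncurry G) (volume.prod volume) := by
    refine ((𝓕 (besselPiece n s l)).integrable.norm.mul_prod
      (integrable_dyadic_mul_bracket n j m (C 0))).mono' ?_ (Eventually.of_forall fun w => ?_)
    · have h1 : Continuous (fun w : Rn n × Rn n => a (z + w.1, y) w.2) :=
        ha.continuous.comp (by fun_prop :
          Continuous fun w : Rn n × Rn n => (((z + w.1, y) : Rn n × Rn n), w.2))
      have h2 := (𝓕 (besselPiece n s l)).continuous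
      have h3 := continuous_dyadic n j
      have : Continuous (Function.uncurry G) := by
        simp only [G, Function.uncurry_def]
        exact (h2.comp continuous_fst).mul
          (Continuous.mul (by fun_prop) ((h3.comp continuous_snd).mul h1))
      exact this.aestronglyMeasurable
    · simp only [G, Function.uncurry_def]
      rw [norm_mul, norm_mul, norm_cexp_I_mul_ofReal, one_mul, norm_mul]
      gcongr
      exact (hC _).norm_le _
  have e1 : composedKernel a s j l z y = ((2 * (Real.pi : ℂ)) ^ n)⁻¹ * ∫ t, ∫ ξ, G t ξ := by
    rw [composedKernel, ← integral_const_mul]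
    congr 1 with t
    rw [dyadicKernel_eq_integral, ← integral_const_mul, ← integral_const_mul,
      ← integral_const_mul]
    congr 1 with ξ
    simp only [G]
    ring
  rw [e1, integral_integral_swap hG]
  congr 2 with ξ
  rw [← integral_const_mul, ← integral_const_mul]
  congr 1 with t
  simp only [G]
  rw [show z + t - y = (z - y) + t by abel, inner_add_left, Complex.ofReal_add, mul_add,
    Complex.exp_add]
  ring

theorem exists_norm_composedKernel_le_of_lt (ha : IsHolderSymbol τ m a) (s : ℝ) {τ' : ℝ}
    (hτ' : 0 < τ') (hττ' : τ' < τ) :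
    ∃ K : ℝ, 0 ≤ K ∧ ∀ (j l : ℕ) (z y : Rn n), j < l → ‖composedKernel a s j l z y‖
      ≤ K * ((2 : ℝ) ^ l) ^ (s - τ') * ((2 : ℝ) ^ j) ^ m * dyadicWeight n j (z - y) := by
  have hτ : 0 < τ := hτ'.trans hττ'
  obtain ⟨M, hM⟩ := exists_nat_interpolate (n + 1) hτ' hττ'
  obtain ⟨K₁, hK₁0, h₁⟩ := exists_norm_composedKernel_mul_pow_le ha s M
  obtain ⟨K₂, hK₂0, h₂⟩ := exists_norm_integral_besselPiece_mul_symbol_le hτ ha s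
  obtain ⟨K₃, hK₃0, h₃⟩ := exists_integral_norm_dyadic_mul_le n m
  refine ⟨K₁ + K₃ * K₂, by positivity, fun j l z y hjl => ?_⟩
  apply le_mul_dyadicWeight
  have a₂ : ‖composedKernel a s j l z y‖
      ≤ K₃ * (K₂ * ((2 : ℝ) ^ l) ^ (s - τ)) * ((2 : ℝ) ^ j) ^ (n + m) := by
    rw [composedKernel_eq_integral ha, norm_mul]
    refine (mul_le_of_le_one_left (norm_nonneg _) (norm_two_pi_pow_inv_le_one n)).trans ?_
    refine (norm_integral_le_integral_norm _).trans (h₃ _ _ j (by positivity) fun ξ hξ => ?_)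
    rw [norm_mul, norm_cexp_I_mul_ofReal, one_mul]
    exact h₂ j l z y ξ hjl hξ
  -- Two scales are mixed: the smallness `ρ = 2^{-l}` comes from the Bessel piece, the distance `r =
  -- 2^j ‖z - y‖` from the operator. The size bound `a₂` has no factor `1 + r`, but `1 + r ≥ 1` can
  -- only help.
  have key := mul_pow_le_of_interpolate (K := ‖composedKernel a s j l z y‖)
    (A := (K₁ + K₃ * K₂) * ((2 : ℝ) ^ l) ^ s * ((2 : ℝ) ^ j) ^ (n + m)) (ρ := ((2 : ℝ) ^ l)⁻¹)
    (r := 2 ^ j * ‖z - y‖) (norm_nonneg _) (by positivity) (by positivity) hτ' hττ' hM ?_ ?_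
  · refine key.trans_eq ?_
    rw [Real.inv_rpow (by positivity), ← Real.rpow_neg (by positivity), sub_eq_add_neg s,
      Real.rpow_add (by positivity : (0 : ℝ) < 2 ^ l)]
    ring
  · refine a₂.trans ?_
    have h4 : ((2 : ℝ) ^ l) ^ (s - τ) ≤
        ((2 : ℝ) ^ l) ^ s * (((2 : ℝ) ^ l)⁻¹ * (1 + 2 ^ j * ‖z - y‖)) ^ τ := by
      rw [sub_eq_add_neg s, Real.rpow_add (by positivity), Real.rpow_neg (by positivity),
        ← Real.inv_rpow (by positivity)]
      gcongr
      refine le_mul_of_one_le_right (by positivity) ?_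
      have : 0 ≤ 2 ^ j * ‖z - y‖ := by positivity
      linarith
    calc K₃ * (K₂ * ((2 : ℝ) ^ l) ^ (s - τ)) * ((2 : ℝ) ^ j) ^ (n + m)
        = (K₃ * K₂) * ((2 : ℝ) ^ l) ^ (s - τ) * ((2 : ℝ) ^ j) ^ (n + m) := by ring
      _ ≤ (K₁ + K₃ * K₂) * (((2 : ℝ) ^ l) ^ s *
          (((2 : ℝ) ^ l)⁻¹ * (1 + 2 ^ j * ‖z - y‖)) ^ τ) * ((2 : ℝ) ^ j) ^ (n + m) := by
        gcongr
        linarith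
      _ = _ := by ring
  · refine (h₁ j l z y hjl.le).trans ?_
    gcongr
    have : 0 ≤ K₃ * K₂ := by positivity
    linarith

end Kernel

/-! ### Young's inequality and families of kernels dominated by convolution kernels -/

/-- Hölder's inequality for the splitting `W f = W^{1-1/p} (W f^p)^{1/p}`, that is, Jensen's
inequality for the measure `W μ`. -/
theorem lintegral_mul_rpow_le {α : Type*} [MeasurableSpace α] {μ : Measure α} {W f : α → ℝ≥0∞}
    (hW : AEMeasurable W μ) (hf : AEMeasurable f μ) {p : ℝ} (hp : 1 ≤ p) :
    (∫⁻ y, W y * f y ∂μ) ^ p ≤ (∫⁻ y, W y ∂μ) ^ (p - 1) * ∫⁻ y, W y * f y ^ p ∂μ := by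
  have hp0 : 0 < p := by linarith
  have h1p : 0 ≤ 1 - 1 / p := by
    rw [sub_nonneg, div_le_one hp0]; exact hp
  have e (y : α) : W y * f y = W y ^ (1 - 1 / p) * (W y * f y ^ p) ^ (1 / p) := by
    rw [ENNReal.mul_rpow_of_nonneg _ _ (by positivity), ← mul_assoc,
      ← ENNReal.rpow_add_of_nonneg _ _ h1p (by positivity), ← ENNReal.rpow_mul,
      mul_one_div_cancel hp0.ne']
    simp
  have h := ENNReal.lintegral_mul_norm_pow_le (μ := μ) hW (hW.mul (hf.pow_const p)) h1p
    (by positivity : 0 ≤ 1 / p) (by ring)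
  simp only [Pi.mul_apply] at h
  simp_rw [← e] at h
  calc (∫⁻ y, W y * f y ∂μ) ^ p
      ≤ ((∫⁻ y, W y ∂μ) ^ (1 - 1 / p) * (∫⁻ y, W y * f y ^ p ∂μ) ^ (1 / p)) ^ p := by gcongr
    _ = _ := by
      rw [ENNReal.mul_rpow_of_nonneg _ _ hp0.le, ← ENNReal.rpow_mul, ← ENNReal.rpow_mul,
        one_div_mul_cancel hp0.ne', ENNReal.rpow_one]
      congr 2
      field_simp

theorem lintegral_lintegral_sub_mul {n : ℕ} {W f : Rn n → ℝ≥0∞} (hW : Measurable W)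
    (hf : Measurable f) :
    ∫⁻ x, ∫⁻ y, W (x - y) * f y = (∫⁻ z, W z) * ∫⁻ y, f y := by
  rw [lintegral_lintegral_swap]
  · rw [← lintegral_const_mul _ hf]
    congr 1 with y
    rw [lintegral_mul_const _ (by fun_prop), lintegral_sub_right_eq_self (fun z => W z) y]
  · exact ((hW.comp (measurable_fst.sub measurable_snd)).mul
      (hf.comp measurable_snd)).aemeasurable

/-- **Young's inequality** for functions dominated by a convolution with an `L¹` kernel. -/
theorem eLpNorm_le_lintegral_mul_eLpNorm {n : ℕ} {W : Rn n → ℝ≥0∞} (hW : Measurable W)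
    {u h : Rn n → ℂ} (hu : Measurable u) (hle : ∀ x, ‖h x‖ₑ ≤ ∫⁻ y, W (x - y) * ‖u y‖ₑ)
    {q : ℝ≥0∞} (hq : 1 ≤ q) (hq' : q ≠ ⊤) :
    eLpNorm h q volume ≤ (∫⁻ z, W z) * eLpNorm u q volume := by
  have hq0 : q ≠ 0 := (zero_lt_one.trans_le hq).ne'
  have hp : 1 ≤ q.toReal := by
    rw [← ENNReal.toReal_one]
    exact (ENNReal.toReal_le_toReal ENNReal.one_ne_top hq').2 hq
  set p := q.toReal
  have hp0 : 0 < p := by linarith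
  rw [eLpNorm_eq_lintegral_rpow_enorm_toReal hq0 hq', eLpNorm_eq_lintegral_rpow_enorm_toReal hq0 hq']
  set A := ∫⁻ z, W z
  have key : ∫⁻ x, ‖h x‖ₑ ^ p ≤ A ^ p * ∫⁻ y, ‖u y‖ₑ ^ p := by
    calc ∫⁻ x, ‖h x‖ₑ ^ p ≤ ∫⁻ x, A ^ (p - 1) * ∫⁻ y, W (x - y) * ‖u y‖ₑ ^ p := by
          refine lintegral_mono fun x => ?_
          calc ‖h x‖ₑ ^ p ≤ (∫⁻ y, W (x - y) * ‖u y‖ₑ) ^ p := by gcongr; exact hle x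
            _ ≤ (∫⁻ y, W (x - y)) ^ (p - 1) * ∫⁻ y, W (x - y) * ‖u y‖ₑ ^ p :=
              lintegral_mul_rpow_le (by fun_prop) (by fun_prop) hp
            _ = _ := by rw [lintegral_sub_left_eq_self (fun z => W z) x]
      _ = A ^ (p - 1) * (A * ∫⁻ y, ‖u y‖ₑ ^ p) := by
          rw [lintegral_const_mul, lintegral_lintegral_sub_mul hW (by fun_prop)]
          refine Measurable.lintegral_prod_right' (f := fun z : Rn n × Rn n =>
            W (z.1 - z.2) * ‖u z.2‖ₑ ^ p) (by fun_prop)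
      _ = _ := by
          rw [← mul_assoc]
          congr 1
          conv_lhs => rw [← ENNReal.rpow_one A, ← ENNReal.rpow_mul, mul_comm (1 : ℝ), mul_one]
          rw [← ENNReal.rpow_add_of_nonneg _ _ (by linarith) zero_le_one]
          simp
  calc _ ≤ (A ^ p * ∫⁻ y, ‖u y‖ₑ ^ p) ^ (1 / p) := by gcongr
    _ = _ := by
      rw [ENNReal.mul_rpow_of_nonneg _ _ (by positivity), ← ENNReal.rpow_mul,
        mul_one_div_cancel hp0.ne', ENNReal.rpow_one]

/-- A countable family of kernels dominated by convolution kernels with summable `L¹`-norms. -/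
structure IsDominatedFamily {n : ℕ} {ι : Type*} (k : ι → Rn n → Rn n → ℂ)
    (W : ι → Rn n → ℝ≥0∞) : Prop where
  stronglyMeasurable : ∀ i, StronglyMeasurable (fun z : Rn n × Rn n => k i z.1 z.2)
  measurable : ∀ i, Measurable (W i)
  enorm_le : ∀ i x y, ‖k i x y‖ₑ ≤ W i (x - y)
  tsum_ne_top : ∑' i, ∫⁻ z, W i z ≠ ⊤

/-- The sum of the integral operators of a family of kernels. -/
noncomputable def kernelOp {n : ℕ} {ι : Type*} (k : ι → Rn n → Rn n → ℂ) (u : 𝓢(Rn n, ℂ))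
    (x : Rn n) : ℂ := ∑' i, ∫ y, k i x y * u y

namespace IsDominatedFamily

variable {n : ℕ} {ι : Type*} {k : ι → Rn n → Rn n → ℂ} {W : ι → Rn n → ℝ≥0∞}

theorem enorm_integral_le (hk : IsDominatedFamily k W) (u : 𝓢(Rn n, ℂ)) (i : ι) (x : Rn n) :
    ‖∫ y, k i x y * u y‖ₑ ≤ ∫⁻ y, W i (x - y) * ‖u y‖ₑ := by
  refine (enorm_integral_le_lintegral_enorm _).trans (lintegral_mono fun y => ?_)
  rw [enorm_mul]
  gcongr
  exact hk.enorm_le i x y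

theorem lintegral_ne_top (hk : IsDominatedFamily k W) (i : ι) : ∫⁻ z, W i z ≠ ⊤ :=
  ENNReal.ne_top_of_tsum_ne_top hk.tsum_ne_top i

theorem exists_enorm_le (u : 𝓢(Rn n, ℂ)) : ∃ B : ℝ≥0∞, B ≠ ⊤ ∧ ∀ x, ‖u x‖ₑ ≤ B := by
  refine ⟨ENNReal.ofReal (SchwartzMap.seminorm ℝ 0 0 u), ENNReal.ofReal_ne_top, fun x => ?_⟩
  rw [← ofReal_norm]
  exact ENNReal.ofReal_le_ofReal (u.norm_le_seminorm ℝ x)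

theorem lintegral_sub_mul_le (hk : IsDominatedFamily k W) {u : Rn n → ℂ} {B : ℝ≥0∞}
    (hB : ∀ x, ‖u x‖ₑ ≤ B) (i : ι) (x : Rn n) :
    ∫⁻ y, W i (x - y) * ‖u y‖ₑ ≤ (∫⁻ z, W i z) * B := by
  have := hk.measurable i
  calc _ ≤ ∫⁻ y, W i (x - y) * B := by gcongr with y; exact hB y
    _ = _ := by
      rw [lintegral_mul_const _ (by fun_prop), lintegral_sub_left_eq_self (fun z => W i z) x]

theorem integrable_mul (hk : IsDominatedFamily k W) (u : 𝓢(Rn n, ℂ)) (i : ι) (x : Rn n) :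
    Integrable (fun y => k i x y * u y) := by
  obtain ⟨B, hB, hu⟩ := exists_enorm_le u
  refine ⟨?_, ?_⟩
  · exact ((hk.stronglyMeasurable i).comp_measurable
      measurable_prodMk_left).aestronglyMeasurable.mul u.continuous.aestronglyMeasurable
  · rw [hasFiniteIntegral_iff_enorm]
    refine lt_of_le_of_lt (lintegral_mono fun y => ?_) (lt_of_le_of_lt
      (hk.lintegral_sub_mul_le hu i x) (ENNReal.mul_lt_top (hk.lintegral_ne_top i).lt_top hB.lt_top))
    rw [enorm_mul]
    gcongr
    exact hk.enorm_le i x y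

theorem summable (hk : IsDominatedFamily k W) (u : 𝓢(Rn n, ℂ)) (x : Rn n) :
    Summable (fun i => ∫ y, k i x y * u y) := by
  obtain ⟨B, hB, hu⟩ := exists_enorm_le u
  refine Summable.of_enorm (ne_top_of_le_ne_top ?_ (ENNReal.tsum_le_tsum fun i =>
    (hk.enorm_integral_le u i x).trans (hk.lintegral_sub_mul_le hu i x)))
  rw [ENNReal.tsum_mul_right]
  exact ENNReal.mul_ne_top hk.tsum_ne_top hB

theorem stronglyMeasurable_integral (hk : IsDominatedFamily k W) (u : 𝓢(Rn n, ℂ)) (i : ι) :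
    StronglyMeasurable (fun x => ∫ y, k i x y * u y) :=
  StronglyMeasurable.integral_prod_right' (f := fun z : Rn n × Rn n => k i z.1 z.2 * u z.2)
    ((hk.stronglyMeasurable i).mul (u.continuous.comp continuous_snd).stronglyMeasurable)

theorem stronglyMeasurable_kernelOp [Countable ι] (hk : IsDominatedFamily k W) (u : 𝓢(Rn n, ℂ)) :
    StronglyMeasurable (kernelOp k u) := by
  refine stronglyMeasurable_of_tendsto (u := (atTop : Filter (Finset ι)))
    (f := fun s x => ∑ i ∈ s, ∫ y, k i x y * u y) (fun s => ?_) ?_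
  · exact Finset.stronglyMeasurable_fun_sum s fun i _ => hk.stronglyMeasurable_integral u i
  · exact tendsto_pi_nhds.2 fun x => (hk.summable u x).hasSum

theorem enorm_kernelOp_le [Countable ι] (hk : IsDominatedFamily k W) (u : 𝓢(Rn n, ℂ)) (x : Rn n) :
    ‖kernelOp k u x‖ₑ ≤ ∫⁻ y, (∑' i, W i (x - y)) * ‖u y‖ₑ := by
  simp_rw [← ENNReal.tsum_mul_right]
  have hm (i : ι) := hk.measurable i
  have hu : Continuous u := u.continuous
  rw [lintegral_tsum fun i => by fun_prop]
  exact (enorm_tsum_le_tsum_enorm).trans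
    (ENNReal.tsum_le_tsum fun i => hk.enorm_integral_le u i x)

theorem eLpNorm_kernelOp_le [Countable ι] (hk : IsDominatedFamily k W) (u : 𝓢(Rn n, ℂ))
    {q : ℝ≥0∞} (hq : 1 ≤ q) (hq' : q ≠ ⊤) :
    eLpNorm (kernelOp k u) q volume ≤ (∑' i, ∫⁻ z, W i z) * eLpNorm u q volume := by
  rw [← lintegral_tsum fun i => (hk.measurable i).aemeasurable]
  exact eLpNorm_le_lintegral_mul_eLpNorm (Measurable.tsum fun i => hk.measurable i)
    u.continuous.measurable (hk.enorm_kernelOp_le u) hq hq'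

theorem memLp_kernelOp [Countable ι] (hk : IsDominatedFamily k W) (u : 𝓢(Rn n, ℂ))
    {q : ℝ≥0∞} (hq : 1 ≤ q) (hq' : q ≠ ⊤) : MemLp (kernelOp k u) q volume :=
  ⟨(hk.stronglyMeasurable_kernelOp u).aestronglyMeasurable, lt_of_le_of_lt
    (hk.eLpNorm_kernelOp_le u hq hq') (ENNReal.mul_lt_top hk.tsum_ne_top.lt_top
      (u.memLp q volume).2)⟩

theorem kernelOp_add (hk : IsDominatedFamily k W) (u v : 𝓢(Rn n, ℂ)) :
    kernelOp k (u + v) = kernelOp k u + kernelOp k v := by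
  ext x
  simp only [kernelOp, Pi.add_apply]
  rw [← (hk.summable u x).tsum_add (hk.summable v x)]
  congr 1 with i
  rw [← integral_add (hk.integrable_mul u i x) (hk.integrable_mul v i x)]
  congr 1 with y
  simp [mul_add]

theorem kernelOp_smul (c : ℂ) (u : 𝓢(Rn n, ℂ)) : kernelOp k (c • u) = c • kernelOp k u := by
  ext x
  simp only [kernelOp, Pi.smul_apply, smul_eq_mul]
  rw [← tsum_mul_left]
  congr 1 with i
  rw [← integral_const_mul]
  congr 1 with y
  simp only [smul_apply, smul_eq_mul]
  ring

/-- The operator of a dominated family as a linear map from Schwartz functions to `L_q`. -/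
noncomputable def toLinearMap [Countable ι] (hk : IsDominatedFamily k W) {q : ℝ≥0∞} (hq : 1 ≤ q)
    (hq' : q ≠ ⊤) : 𝓢(Rn n, ℂ) →ₗ[ℂ] Lp ℂ q (volume : Measure (Rn n)) where
  toFun u := (hk.memLp_kernelOp u hq hq').toLp (kernelOp k u)
  map_add' u v := by
    rw [← MemLp.toLp_add]
    congr 1
    exact hk.kernelOp_add u v
  map_smul' c u := by
    rw [RingHom.id_apply, ← MemLp.toLp_const_smul]
    congr 1
    exact kernelOp_smul c u

theorem norm_toLinearMap_le [Countable ι] (hk : IsDominatedFamily k W) {q : ℝ≥0∞} (hq : 1 ≤ q)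
    (hq' : q ≠ ⊤) (u : 𝓢(Rn n, ℂ)) :
    ‖hk.toLinearMap hq hq' u‖ ≤ (∑' i, ∫⁻ z, W i z).toReal * ‖u.toLp q‖ := by
  have h : ‖hk.toLinearMap hq hq' u‖ = (eLpNorm (kernelOp k u) q volume).toReal :=
    Lp.norm_toLp _ (hk.memLp_kernelOp u hq hq')
  rw [h, SchwartzMap.norm_toLp, ← ENNReal.toReal_mul]
  exact ENNReal.toReal_mono (ENNReal.mul_ne_top hk.tsum_ne_top (u.memLp q volume).2.ne)
    (hk.eLpNorm_kernelOp_le u hq hq')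

/-- Extension by continuity: Schwartz functions are dense in `L_q` for `q ≠ ⊤`, and Young's
inequality bounds the operator by the summed `L¹`-norms of the majorants. -/
theorem exists_clm [Countable ι] (hk : IsDominatedFamily k W) (q : ℝ≥0∞) [Fact (1 ≤ q)]
    (hq' : q ≠ ⊤) :
    ∃ S : Lp ℂ q (volume : Measure (Rn n)) →L[ℂ] Lp ℂ q (volume : Measure (Rn n)),
      ∀ u : 𝓢(Rn n, ℂ), S (u.toLp q) = (hk.memLp_kernelOp u Fact.out hq').toLp (kernelOp k u) := by
  have hd : DenseRange (SchwartzMap.toLpCLM ℂ ℂ q (volume : Measure (Rn n))).toLinearMap :=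
    SchwartzMap.denseRange_toLpCLM (F := ℂ) hq'
  exact ⟨(hk.toLinearMap Fact.out hq').extendOfNorm
      (SchwartzMap.toLpCLM ℂ ℂ q (volume : Measure (Rn n))).toLinearMap,
    fun u => LinearMap.extendOfNorm_eq hd ⟨_, hk.norm_toLinearMap_le Fact.out hq'⟩ u⟩

theorem integrable_integral (hk : IsDominatedFamily k W) (u : 𝓢(Rn n, ℂ)) (i : ι) :
    Integrable (fun x => ∫ y, k i x y * u y) := by
  rw [← memLp_one_iff_integrable]
  refine ⟨(hk.stronglyMeasurable_integral u i).aestronglyMeasurable, lt_of_le_of_lt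
    (eLpNorm_le_lintegral_mul_eLpNorm (hk.measurable i) u.continuous.measurable
      (hk.enorm_integral_le u i) le_rfl ENNReal.one_ne_top)
    (ENNReal.mul_lt_top (hk.lintegral_ne_top i).lt_top (u.memLp 1 volume).2)⟩

/-- The test function is bounded and `u` is integrable, so Young's inequality in `L¹` makes the
series absolutely convergent in `L¹` and the sum can be taken out of the pairing. -/
theorem hasSum_integral_mul [Countable ι] (hk : IsDominatedFamily k W) (u φ : 𝓢(Rn n, ℂ)) :
    HasSum (fun i => ∫ x, φ x * ∫ y, k i x y * u y) (∫ x, φ x * kernelOp k u x) := by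
  obtain ⟨B, hB, hφ⟩ := exists_enorm_le φ
  have hle (i : ι) : ∫⁻ x, ‖φ x * ∫ y, k i x y * u y‖ₑ
      ≤ (∫⁻ z, W i z) * (B * eLpNorm u 1 volume) := by
    calc _ ≤ ∫⁻ x, B * ‖∫ y, k i x y * u y‖ₑ := by
          refine lintegral_mono fun x => ?_
          rw [enorm_mul]
          gcongr
          exact hφ x
      _ = B * eLpNorm (fun x => ∫ y, k i x y * u y) 1 volume := by
          rw [lintegral_const_mul _ (hk.stronglyMeasurable_integral u i).measurable.enorm,
            eLpNorm_one_eq_lintegral_enorm]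
      _ ≤ B * ((∫⁻ z, W i z) * eLpNorm u 1 volume) := by
          gcongr
          exact eLpNorm_le_lintegral_mul_eLpNorm (hk.measurable i) u.continuous.measurable
            (hk.enorm_integral_le u i) le_rfl ENNReal.one_ne_top
      _ = _ := by ring
  have hm (i : ι) : AEStronglyMeasurable (fun x => φ x * ∫ y, k i x y * u y) volume :=
    φ.continuous.aestronglyMeasurable.mul (hk.stronglyMeasurable_integral u i).aestronglyMeasurable
  have hfin : ∑' i, ∫⁻ x, ‖φ x * ∫ y, k i x y * u y‖ₑ ≠ ⊤ := by
    refine ne_top_of_le_ne_top ?_ (ENNReal.tsum_le_tsum hle)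
    rw [ENNReal.tsum_mul_right]
    exact ENNReal.mul_ne_top hk.tsum_ne_top (ENNReal.mul_ne_top hB (u.memLp 1 volume).2.ne)
  have h := hasSum_integral_of_summable_integral_norm
    (F := fun i x => φ x * ∫ y, k i x y * u y) (fun i => ⟨hm i, ?_⟩) ?_
  · have e : (fun x => φ x * kernelOp k u x) = fun x => ∑' i, φ x * ∫ y, k i x y * u y := by
      ext x
      rw [tsum_mul_left]
      rfl
    rw [e]
    exact h
  · exact (ENNReal.ne_top_of_tsum_ne_top hfin i).lt_top
  · have : (fun i => ∫ x, ‖φ x * ∫ y, k i x y * u y‖)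
        = fun i => (∫⁻ x, ‖φ x * ∫ y, k i x y * u y‖ₑ).toReal := by
      ext i
      rw [integral_norm_eq_lintegral_enorm (hm i)]
    rw [this]
    exact ENNReal.summable_toReal hfin

end IsDominatedFamily

/-! ### The kernels of `op(a)` and of its Bessel potential are dominated families -/

theorem two_pow_rpow_comm (j : ℕ) (r : ℝ) : ((2 : ℝ) ^ j) ^ r = ((2 : ℝ) ^ r) ^ j := by
  rw [← Real.rpow_natCast, ← Real.rpow_natCast, ← Real.rpow_mul (by norm_num),
    ← Real.rpow_mul (by norm_num), mul_comm]

theorem summable_two_pow_rpow {r : ℝ} (hr : r < 0) : Summable fun j : ℕ => ((2 : ℝ) ^ j) ^ r := by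
  simp_rw [two_pow_rpow_comm]
  exact summable_geometric_of_lt_one (by positivity)
    (Real.rpow_lt_one_of_one_lt_of_neg one_lt_two hr)

theorem lintegral_ofReal_mul_dyadicWeight (n j : ℕ) {B : ℝ} (hB : 0 ≤ B) :
    ∫⁻ z, ENNReal.ofReal (B * dyadicWeight n j z)
      = ENNReal.ofReal (B * ∫ z : Rn n, ((1 + ‖z‖) ^ (n + 1))⁻¹) := by
  rw [← ofReal_integral_eq_lintegral_ofReal ((integrable_dyadicWeight n j).const_mul B)
    (Eventually.of_forall fun z => mul_nonneg hB (dyadicWeight_nonneg n j z)),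
    integral_const_mul, integral_dyadicWeight]

theorem measurable_ofReal_mul_dyadicWeight (n j : ℕ) (B : ℝ) :
    Measurable fun z => ENNReal.ofReal (B * dyadicWeight n j z) :=
  ((continuous_dyadicWeight n j).measurable.const_mul B).ennreal_ofReal

section

variable {n : ℕ} {τ m : ℝ} {a : Rn n × Rn n → Rn n → ℂ}

/-- The convolution kernel dominating `dyadicKernel a j`. -/
noncomputable def dyadicMajorant (n : ℕ) (K r : ℝ) (j : ℕ) (z : Rn n) : ℝ≥0∞ :=
  ENNReal.ofReal (K * ((2 : ℝ) ^ j) ^ r * dyadicWeight n j z)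

theorem lintegral_dyadicMajorant (n : ℕ) {K : ℝ} (hK : 0 ≤ K) (r : ℝ) (j : ℕ) :
    ∫⁻ z, dyadicMajorant n K r j z
      = ENNReal.ofReal (K * ((2 : ℝ) ^ j) ^ r * ∫ z : Rn n, ((1 + ‖z‖) ^ (n + 1))⁻¹) :=
  lintegral_ofReal_mul_dyadicWeight n j (by positivity)

theorem tsum_lintegral_dyadicMajorant_ne_top (n : ℕ) {K : ℝ} (hK : 0 ≤ K) {r : ℝ} (hr : r < 0) :
    ∑' j, ∫⁻ z, dyadicMajorant n K r j z ≠ ⊤ := by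
  simp_rw [lintegral_dyadicMajorant n hK r]
  refine Summable.tsum_ofReal_ne_top ?_
  exact ((summable_two_pow_rpow hr).mul_left K).mul_right _

theorem exists_isDominatedFamily_dyadicKernel {τ' : ℝ} (hτ' : 0 < τ') (hττ' : τ' < τ)
    (hm : m < τ') (ha : IsHolderSymbol τ m a)
    (hdiag : ∀ x ξ : Rn n, ∀ j : ℕ, (j : ℝ) < τ →
      iteratedFDeriv ℝ j (fun X : Rn n × Rn n => a X ξ) (x, x) = 0) :
    ∃ K : ℝ, 0 ≤ K ∧ IsDominatedFamily (dyadicKernel a) (dyadicMajorant n K (m - τ')) := by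
  obtain ⟨K, hK0, hK⟩ := exists_norm_dyadicKernel_le hτ' hττ' ha hdiag
  refine ⟨K, hK0, fun j => (continuous_dyadicKernel ha j).stronglyMeasurable,
    fun j => measurable_ofReal_mul_dyadicWeight n j _, fun j x y => ?_,
    tsum_lintegral_dyadicMajorant_ne_top n hK0 (by linarith)⟩
  rw [← ofReal_norm]
  exact ENNReal.ofReal_le_ofReal (hK j x y)

/-- The convolution kernel dominating `composedKernel a s j l`. -/
noncomputable def composedMajorant (n : ℕ) (s K₁ r₁ K₂ r₂ r₃ : ℝ) (i : ℕ × ℕ) (z : Rn n) : ℝ≥0∞ :=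
  if i.2 ≤ i.1 then ∫⁻ t, ‖𝓕 (besselPiece n s i.2) t‖ₑ * dyadicMajorant n K₁ r₁ i.1 (z + t)
  else dyadicMajorant n (K₂ * ((2 : ℝ) ^ i.2) ^ r₂) r₃ i.1 z

theorem measurable_dyadicMajorant (n : ℕ) (K r : ℝ) (j : ℕ) :
    Measurable (dyadicMajorant n K r j) :=
  measurable_ofReal_mul_dyadicWeight n j _

theorem measurable_composedMajorant (n : ℕ) (s K₁ r₁ K₂ r₂ r₃ : ℝ) (i : ℕ × ℕ) :
    Measurable (composedMajorant n s K₁ r₁ K₂ r₂ r₃ i) := by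
  have h1 := measurable_dyadicMajorant n K₁ r₁ i.1
  have h2 := (𝓕 (besselPiece n s i.2)).continuous.measurable
  unfold composedMajorant
  split_ifs
  · exact Measurable.lintegral_prod_right' (f := fun z : Rn n × Rn n =>
      ‖𝓕 (besselPiece n s i.2) z.2‖ₑ * dyadicMajorant n K₁ r₁ i.1 (z.1 + z.2)) (by fun_prop)
  · exact measurable_dyadicMajorant n _ _ _

theorem lintegral_composedMajorant_of_le (n : ℕ) (s K₁ r₁ K₂ r₂ r₃ : ℝ) {j l : ℕ} (h : l ≤ j) :
    ∫⁻ z, composedMajorant n s K₁ r₁ K₂ r₂ r₃ (j, l) z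
      = (∫⁻ t, ‖𝓕 (besselPiece n s l) t‖ₑ) * ∫⁻ z, dyadicMajorant n K₁ r₁ j z := by
  have h1 := measurable_dyadicMajorant n K₁ r₁ j
  have h2 := (𝓕 (besselPiece n s l)).continuous.measurable
  simp only [composedMajorant, h, if_true]
  rw [lintegral_lintegral_swap (by fun_prop), ← lintegral_mul_const _ (by fun_prop)]
  congr 1 with t
  rw [lintegral_const_mul _ (by fun_prop),
    lintegral_add_right_eq_self (fun z => dyadicMajorant n K₁ r₁ j z) t]

/-- As `s` and `m` are nonnegative, the positive power of the smaller of `2^j`, `2^l` may be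
replaced by that of the larger, which then carries the exponent `s + m - τ' = -2δ`. Giving half of
it back to the smaller one produces a product of two convergent geometric series. -/
theorem exists_lintegral_composedMajorant_le (n : ℕ) {s K₁ K₂ τ' : ℝ} (hs : 0 ≤ s) (hK₁ : 0 ≤ K₁)
    (hK₂ : 0 ≤ K₂) (hm : 0 ≤ m) (hτ' : s + m < τ') :
    ∃ K δ : ℝ, 0 ≤ K ∧ 0 < δ ∧ ∀ j l : ℕ,
      ∫⁻ z, composedMajorant n s K₁ (m - τ') K₂ (s - τ') m (j, l) z
        ≤ ENNReal.ofReal (K * (((2 : ℝ) ^ j) ^ (-δ) * ((2 : ℝ) ^ l) ^ (-δ))) := by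
  obtain ⟨K₃, hK₃0, hK₃⟩ := exists_integral_fourier_besselPiece_le n s 0
  simp only [pow_zero, mul_one] at hK₃
  set c := ∫ z : Rn n, ((1 + ‖z‖) ^ (n + 1))⁻¹
  have hc : 0 ≤ c := integral_nonneg fun _ => by positivity
  refine ⟨(K₃ * K₁ + K₂) * c, (τ' - s - m) / 2, by positivity, by linarith, fun j l => ?_⟩
  set δ := (τ' - s - m) / 2 with hδ
  have hδ0 : 0 < δ := by rw [hδ]; linarith
  have hK3K1 : 0 ≤ K₃ * K₁ := by positivity
  rcases le_or_gt l j with h | h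
  · have hjl : (2 : ℝ) ^ l ≤ 2 ^ j := pow_le_pow_right₀ one_le_two h
    rw [lintegral_composedMajorant_of_le n _ _ _ _ _ _ h, lintegral_dyadicMajorant n hK₁]
    have h1 : ∫⁻ t, ‖𝓕 (besselPiece n s l) t‖ₑ ≤ ENNReal.ofReal (K₃ * ((2 : ℝ) ^ l) ^ s) := by
      rw [← ofReal_integral_norm_eq_lintegral_enorm (𝓕 (besselPiece n s l)).integrable]
      exact ENNReal.ofReal_le_ofReal (hK₃ l).2
    refine (mul_le_mul_left h1 _).trans ?_
    rw [← ENNReal.ofReal_mul (by positivity)]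
    refine ENNReal.ofReal_le_ofReal ?_
    have h2 : ((2 : ℝ) ^ l) ^ s * ((2 : ℝ) ^ j) ^ (m - τ')
        ≤ ((2 : ℝ) ^ j) ^ (-δ) * ((2 : ℝ) ^ l) ^ (-δ) := by
      calc ((2 : ℝ) ^ l) ^ s * ((2 : ℝ) ^ j) ^ (m - τ')
          ≤ ((2 : ℝ) ^ j) ^ s * ((2 : ℝ) ^ j) ^ (m - τ') := by gcongr
        _ = ((2 : ℝ) ^ j) ^ (-δ) * ((2 : ℝ) ^ j) ^ (-δ) := by
          rw [← Real.rpow_add (by positivity), ← Real.rpow_add (by positivity)]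
          congr 1; rw [hδ]; ring
        _ ≤ _ := mul_le_mul_of_nonneg_left
          (Real.rpow_le_rpow_of_nonpos (by positivity) hjl (by linarith)) (by positivity)
    calc K₃ * ((2 : ℝ) ^ l) ^ s * (K₁ * ((2 : ℝ) ^ j) ^ (m - τ') * c)
        = K₃ * K₁ * c * (((2 : ℝ) ^ l) ^ s * ((2 : ℝ) ^ j) ^ (m - τ')) := by ring
      _ ≤ (K₃ * K₁ + K₂) * c * (((2 : ℝ) ^ j) ^ (-δ) * ((2 : ℝ) ^ l) ^ (-δ)) := by
        gcongr
        linarith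
  · have hjl : (2 : ℝ) ^ j ≤ 2 ^ l := pow_le_pow_right₀ one_le_two h.le
    simp only [composedMajorant, not_le.2 h, if_false]
    rw [lintegral_dyadicMajorant n (by positivity)]
    refine ENNReal.ofReal_le_ofReal ?_
    have h2 : ((2 : ℝ) ^ l) ^ (s - τ') * ((2 : ℝ) ^ j) ^ m
        ≤ ((2 : ℝ) ^ j) ^ (-δ) * ((2 : ℝ) ^ l) ^ (-δ) := by
      calc ((2 : ℝ) ^ l) ^ (s - τ') * ((2 : ℝ) ^ j) ^ m
          ≤ ((2 : ℝ) ^ l) ^ (s - τ') * ((2 : ℝ) ^ l) ^ m := by gcongr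
        _ = ((2 : ℝ) ^ l) ^ (-δ) * ((2 : ℝ) ^ l) ^ (-δ) := by
          rw [← Real.rpow_add (by positivity), ← Real.rpow_add (by positivity)]
          congr 1; rw [hδ]; ring
        _ ≤ _ := by
          gcongr ?_ * _
          exact Real.rpow_le_rpow_of_nonpos (by positivity) hjl (by linarith)
    calc K₂ * ((2 : ℝ) ^ l) ^ (s - τ') * ((2 : ℝ) ^ j) ^ m * c
        = K₂ * c * (((2 : ℝ) ^ l) ^ (s - τ') * ((2 : ℝ) ^ j) ^ m) := by ring
      _ ≤ (K₃ * K₁ + K₂) * c * (((2 : ℝ) ^ j) ^ (-δ) * ((2 : ℝ) ^ l) ^ (-δ)) := by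
        gcongr
        linarith

theorem tsum_lintegral_composedMajorant_ne_top (n : ℕ) {s K₁ K₂ τ' : ℝ} (hs : 0 ≤ s)
    (hK₁ : 0 ≤ K₁) (hK₂ : 0 ≤ K₂) (hm : 0 ≤ m) (hτ' : s + m < τ') :
    ∑' i, ∫⁻ z, composedMajorant n s K₁ (m - τ') K₂ (s - τ') m i z ≠ ⊤ := by
  obtain ⟨K, δ, hK, hδ, h⟩ := exists_lintegral_composedMajorant_le n hs hK₁ hK₂ hm hτ'
  refine ne_top_of_le_ne_top ?_ (ENNReal.tsum_le_tsum fun i => h i.1 i.2)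
  refine Summable.tsum_ofReal_ne_top (Summable.mul_left K ?_)
  have hs := summable_two_pow_rpow (r := -δ) (by linarith)
  exact hs.mul_of_nonneg hs (fun _ => by positivity) (fun _ => by positivity)

theorem stronglyMeasurable_composedKernel (ha : IsHolderSymbol τ m a) (s : ℝ) (j l : ℕ) :
    StronglyMeasurable (fun z : Rn n × Rn n => composedKernel a s j l z.1 z.2) := by
  refine StronglyMeasurable.integral_prod_right' (f := fun w : (Rn n × Rn n) × Rn n =>
    𝓕 (besselPiece n s l) w.2 * dyadicKernel a j (w.1.1 + w.2) w.1.2) ?_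
  have h1 := (𝓕 (besselPiece n s l)).continuous
  have h2 : Continuous (fun w : (Rn n × Rn n) × Rn n => dyadicKernel a j (w.1.1 + w.2) w.1.2) :=
    Continuous.comp (g := fun z : Rn n × Rn n => dyadicKernel a j z.1 z.2)
      (f := fun w : (Rn n × Rn n) × Rn n => (w.1.1 + w.2, w.1.2))
      (continuous_dyadicKernel ha j) (by fun_prop)
  exact ((h1.comp continuous_snd).mul h2).stronglyMeasurable

theorem exists_isDominatedFamily_composedKernel {s τ' : ℝ} (hs : 0 ≤ s) (hm : 0 ≤ m)
    (hτ' : s + m < τ') (hττ' : τ' < τ) (ha : IsHolderSymbol τ m a)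
    (hdiag : ∀ x ξ : Rn n, ∀ j : ℕ, (j : ℝ) < τ →
      iteratedFDeriv ℝ j (fun X : Rn n × Rn n => a X ξ) (x, x) = 0) :
    ∃ K₁ K₂ : ℝ, IsDominatedFamily (fun i : ℕ × ℕ => composedKernel a s i.1 i.2)
      (composedMajorant n s K₁ (m - τ') K₂ (s - τ') m) := by
  have hτ'0 : 0 < τ' := by linarith
  obtain ⟨K₁, hK₁0, hK₁⟩ := exists_norm_dyadicKernel_le hτ'0 hττ' ha hdiag
  obtain ⟨K₂, hK₂0, hK₂⟩ := exists_norm_composedKernel_le_of_lt ha s hτ'0 hττ'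
  refine ⟨K₁, K₂, fun i => stronglyMeasurable_composedKernel ha s i.1 i.2,
    measurable_composedMajorant n _ _ _ _ _ _, fun i z y => ?_,
    tsum_lintegral_composedMajorant_ne_top n hs hK₁0 hK₂0 hm hτ'⟩
  obtain ⟨j, l⟩ := i
  rcases le_or_gt l j with h | h
  · simp only [composedMajorant, h, if_true]
    refine (enorm_integral_le_lintegral_enorm _).trans (lintegral_mono fun t => ?_)
    rw [enorm_mul, show z - y + t = z + t - y by abel]
    gcongr
    rw [← ofReal_norm]
    exact ENNReal.ofReal_le_ofReal (hK₁ j (z + t) y)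
  · simp only [composedMajorant, not_le.2 h, if_false]
    rw [← ofReal_norm]
    exact ENNReal.ofReal_le_ofReal (hK₂ j l z y h)

end

/-! ### The Bessel potential of the operator -/

theorem norm_dyadic_le_two (n j : ℕ) (ξ : Rn n) : ‖dyadic n j ξ‖ ≤ 2 := by
  cases j with
  | zero => exact (norm_lowCutoff_le_one ξ).trans one_le_two
  | succ j =>
    refine (norm_sub_le _ _).trans ?_
    linarith [norm_lowCutoff_le_one (((2 : ℝ) ^ (j + 1))⁻¹ • ξ),
      norm_lowCutoff_le_one (((2 : ℝ) ^ j)⁻¹ • ξ)]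

theorem tendsto_lowCutoff_inv_two_pow_smul {n : ℕ} (ξ : Rn n) :
    Tendsto (fun J : ℕ => lowCutoff n (((2 : ℝ) ^ J)⁻¹ • ξ)) atTop (𝓝 1) := by
  obtain ⟨J, hJ⟩ := pow_unbounded_of_one_lt ‖ξ‖ one_lt_two
  refine tendsto_const_nhds.congr' ((eventually_ge_atTop J).mono fun k hk => ?_)
  refine (lowCutoff_eq_one ?_).symm
  rw [norm_inv_two_pow_smul, div_le_one (by positivity)]
  exact hJ.le.trans (pow_le_pow_right₀ one_le_two hk)

theorem integrable_dyadic_mul {n : ℕ} {α : Type*} [MeasurableSpace α] {μ : Measure α}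
    {π : α → Rn n} (hπ : Measurable π) {F : α → ℂ} (hF : Integrable F μ) (j : ℕ) :
    Integrable (fun w => dyadic n j (π w) * F w) μ :=
  hF.bdd_mul ((continuous_dyadic n j).measurable.comp hπ).aestronglyMeasurable
    (c := 2) (Eventually.of_forall fun w => norm_dyadic_le_two n j (π w))

/-- The dyadic pieces of an integral sum up to the integral. -/
theorem tendsto_sum_integral_dyadic_mul {n : ℕ} {α : Type*} [MeasurableSpace α] {μ : Measure α}
    {π : α → Rn n} (hπ : Measurable π) {F : α → ℂ} (hF : Integrable F μ) :
    Tendsto (fun N => ∑ j ∈ Finset.range N, ∫ w, dyadic n j (π w) * F w ∂μ) atTop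
      (𝓝 (∫ w, F w ∂μ)) := by
  rw [← tendsto_add_atTop_iff_nat 1]
  -- The partition telescopes to a single cutoff bounded by `1` and tending to `1` pointwise, so
  -- `‖F‖` dominates all partial sums.
  have e (J : ℕ) : ∑ j ∈ Finset.range (J + 1), ∫ w, dyadic n j (π w) * F w ∂μ
      = ∫ w, lowCutoff n (((2 : ℝ) ^ J)⁻¹ • π w) * F w ∂μ := by
    rw [← integral_finsetSum _ fun j _ => integrable_dyadic_mul hπ hF j]
    simp_rw [← Finset.sum_mul, sum_dyadic]
  simp_rw [e]
  refine tendsto_integral_of_dominated_convergence (fun w => ‖F w‖) (fun J => ?_) hF.norm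
    (fun J => Eventually.of_forall fun w => ?_) (Eventually.of_forall fun w => ?_)
  · have h1 : Measurable (fun w => ((2 : ℝ) ^ J)⁻¹ • π w) := hπ.const_smul (((2 : ℝ) ^ J)⁻¹)
    have h2 : Measurable (lowCutoff n) := (lowCutoff n).continuous.measurable
    exact (h2.comp h1).aestronglyMeasurable.mul hF.1
  · rw [norm_mul]
    exact mul_le_of_le_one_left (norm_nonneg _) (norm_lowCutoff_le_one _)
  · simpa using (tendsto_lowCutoff_inv_two_pow_smul (π w)).mul_const (F w)

theorem continuous_fourier {n : ℕ} {v : Rn n → ℂ} (hv : Integrable v) : Continuous (𝓕 v) :=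
  VectorFourier.fourierIntegral_continuous Real.continuous_fourierChar
    (by exact continuous_inner) hv

theorem integral_fourier_mul_eq {n : ℕ} {v w : Rn n → ℂ} (hv : Integrable v) (hw : Integrable w) :
    ∫ ξ, 𝓕 v ξ * w ξ = ∫ x, v x * 𝓕 w x := by
  simpa using! VectorFourier.integral_fourierIntegral_smul_eq_flip (L := innerₗ (Rn n))
    Real.continuous_fourierChar continuous_inner hv hw

theorem fourier_comp_add_left {n : ℕ} (v : Rn n → ℂ) (z ξ : Rn n) :
    𝓕 (fun t => v (z + t)) ξ = (Real.fourierChar (inner ℝ z ξ) : ℂ) * 𝓕 v ξ := by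
  have h := congrFun (VectorFourier.fourierIntegral_comp_add_right Real.fourierChar
    (volume : Measure (Rn n)) (innerₗ (Rn n)) v z) ξ
  simp_rw [add_comm z]
  exact h

/-- Pairing of a convolution with the Fourier transform of a Schwartz function. -/
theorem integral_mul_integral_fourier_mul_comp_add {n : ℕ} (ψ φ : 𝓢(Rn n, ℂ)) {v : Rn n → ℂ}
    (hv : Integrable v) :
    ∫ z, φ z * ∫ t, 𝓕 ψ t * v (z + t) = ∫ ξ, ψ ξ * (𝓕⁻ φ ξ * 𝓕 v ξ) := by
  have h1 (z : Rn n) : ∫ t, 𝓕 ψ t * v (z + t)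
      = ∫ ξ, ψ ξ * ((Real.fourierChar (inner ℝ z ξ) : ℂ) * 𝓕 v ξ) := by
    rw [SchwartzMap.fourier_coe, integral_fourier_mul_eq ψ.integrable (hv.comp_add_left z)]
    simp_rw [fourier_comp_add_left]
  simp_rw [h1, ← integral_const_mul]
  rw [integral_integral_swap]
  · congr 1 with ξ
    rw [SchwartzMap.fourierInv_coe, Real.fourierInv_eq, ← integral_mul_const, ← integral_const_mul]
    congr 1 with z
    rw [Circle.smul_def, smul_eq_mul]
    ring
  · refine (φ.integrable.norm.mul_prod ((ψ.integrable.norm.mul_const (∫ t, ‖v t‖)))).mono' ?_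
      (Eventually.of_forall fun w => ?_)
    · have h2 := continuous_fourier hv
      have h3 : Continuous (fun w : Rn n × Rn n => (Real.fourierChar (inner ℝ w.1 w.2) : ℂ)) :=
        continuous_subtype_val.comp (Real.continuous_fourierChar.comp continuous_inner)
      exact ((φ.continuous.comp continuous_fst).mul ((ψ.continuous.comp continuous_snd).mul
        (h3.mul (h2.comp continuous_snd)))).aestronglyMeasurable
    · simp only [Function.uncurry_def, norm_mul, Circle.norm_coe, one_mul]
      gcongr
      exact norm_fourier_le_integral_norm v _

section

variable {n : ℕ} {τ m : ℝ} {a : Rn n × Rn n → Rn n → ℂ}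

theorem exists_norm_dyadicKernel_le_const (ha : IsHolderSymbol τ m a) (j : ℕ) :
    ∃ B : ℝ, ∀ x y, ‖dyadicKernel a j x y‖ ≤ B := by
  obtain ⟨C, hC⟩ := ha.exists_symbolBound
  refine ⟨∫ ξ : Rn n, ‖dyadic n j ξ‖ * (C 0 * (1 + ‖ξ‖ ^ 2) ^ (m / 2)), fun x y => ?_⟩
  rw [dyadicKernel, norm_mul]
  refine (mul_le_of_le_one_left (norm_nonneg _) (norm_two_pi_pow_inv_le_one n)).trans ?_
  refine (norm_fourier_le_integral_norm _ _).trans (integral_mono_of_nonneg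
    (Eventually.of_forall fun _ => norm_nonneg _) (integrable_dyadic_mul_bracket n j m (C 0))
    (Eventually.of_forall fun ξ => ?_))
  dsimp only
  rw [norm_mul]
  gcongr
  exact (hC _).norm_le ξ

theorem integral_composedKernel_mul (ha : IsHolderSymbol τ m a) (s : ℝ) (j l : ℕ)
    (u : 𝓢(Rn n, ℂ)) (z : Rn n) :
    ∫ y, composedKernel a s j l z y * u y
      = ∫ t, 𝓕 (besselPiece n s l) t * ∫ y, dyadicKernel a j (z + t) y * u y := by
  obtain ⟨B, hB⟩ := exists_norm_dyadicKernel_le_const ha j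
  simp_rw [composedKernel, ← integral_mul_const, ← integral_const_mul]
  rw [integral_integral_swap]
  · simp_rw [mul_assoc]
  · refine ((u.integrable.norm.mul_const B).mul_prod
      (𝓕 (besselPiece n s l)).integrable.norm).mono' ?_ (Eventually.of_forall fun w => ?_)
    · have h2 : Continuous (fun w : Rn n × Rn n => dyadicKernel a j (z + w.2) w.1) :=
        Continuous.comp (g := fun z : Rn n × Rn n => dyadicKernel a j z.1 z.2)
          (f := fun w : Rn n × Rn n => (z + w.2, w.1)) (continuous_dyadicKernel ha j) (by fun_prop)
      exact ((((𝓕 (besselPiece n s l)).continuous.comp continuous_snd).mul h2).mul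
        (u.continuous.comp continuous_fst)).aestronglyMeasurable
    · simp only [Function.uncurry_def, norm_mul]
      calc _ = ‖u w.1‖ * ‖dyadicKernel a j (z + w.2) w.1‖ * ‖𝓕 (besselPiece n s l) w.2‖ := by ring
        _ ≤ _ := by gcongr; exact hB _ _

theorem hasTemperateGrowth_bracket (n : ℕ) (s : ℝ) :
    (fun ξ : Rn n => (((1 + ‖ξ‖ ^ 2) ^ (s / 2) : ℝ) : ℂ)).HasTemperateGrowth := by
  fun_prop

/-- The double series converges, so it may be summed over `l` first. For fixed `j`, each term is `∫
dyadic n l · ρ · 𝓕 v` with `v` the `j`-th piece of the operator; the sum over `l` removes the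
cutoff, and moving `𝓕` onto `ρ` gives the `j`-th term of the right-hand side. -/
theorem integral_mul_kernelOp_composedKernel (ha : IsHolderSymbol τ m a) {s : ℝ}
    {W : ℕ → Rn n → ℝ≥0∞} {W' : ℕ × ℕ → Rn n → ℝ≥0∞}
    (hk : IsDominatedFamily (dyadicKernel a) W)
    (hk' : IsDominatedFamily (fun i : ℕ × ℕ => composedKernel a s i.1 i.2) W')
    (u φ : 𝓢(Rn n, ℂ)) :
    ∫ x, φ x * kernelOp (fun i : ℕ × ℕ => composedKernel a s i.1 i.2) u x
      = ∫ x, 𝓕 (SchwartzMap.smulLeftCLM ℂ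
          (fun ξ : Rn n => (((1 + ‖ξ‖ ^ 2) ^ (s / 2) : ℝ) : ℂ)) (𝓕⁻ φ)) x *
            kernelOp (dyadicKernel a) u x := by
  set ρ := SchwartzMap.smulLeftCLM ℂ
    (fun ξ : Rn n => (((1 + ‖ξ‖ ^ 2) ^ (s / 2) : ℝ) : ℂ)) (𝓕⁻ φ) with hρ
  have hρ' (ξ : Rn n) : ρ ξ = (((1 + ‖ξ‖ ^ 2) ^ (s / 2) : ℝ) : ℂ) * 𝓕⁻ φ ξ := by
    rw [hρ, SchwartzMap.smulLeftCLM_apply_apply (hasTemperateGrowth_bracket n s), smul_eq_mul]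
  have h1 := hk'.hasSum_integral_mul u φ
  have h2 := hk.hasSum_integral_mul u (𝓕 ρ)
  refine (h1.prod_fiberwise fun j => ?_).unique h2
  have hv := hk.integrable_integral u j
  set v : Rn n → ℂ := fun x => ∫ y, dyadicKernel a j x y * u y with hvdef
  have hF : Integrable (fun ξ => ρ ξ * 𝓕 v ξ) :=
    ρ.integrable.mul_bdd (c := ∫ t, ‖v t‖) (continuous_fourier hv).aestronglyMeasurable
      (Eventually.of_forall fun ξ => norm_fourier_le_integral_norm v ξ)
  have e (l : ℕ) : ∫ x, φ x * ∫ y, composedKernel a s j l x y * u y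
      = ∫ ξ, dyadic n l ξ * (ρ ξ * 𝓕 v ξ) := by
    simp_rw [integral_composedKernel_mul ha]
    refine (integral_mul_integral_fourier_mul_comp_add (besselPiece n s l) φ hv).trans ?_
    congr 1 with ξ
    rw [hρ', coe_besselPiece]
    ring
  have h3 := (h1.summable.prod_factor j).hasSum
  have h4 := tendsto_sum_integral_dyadic_mul (π := fun ξ : Rn n => ξ) measurable_id hF
  rw [← integral_fourier_mul_eq ρ.integrable hv] at h4
  simp_rw [← e] at h4
  have h5 := tendsto_nhds_unique h3.tendsto_sum_nat h4
  rw [h5] at h3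
  exact h3

/-- The Bessel potential of the operator is the operator of the family of composed kernels. -/
theorem besselPotential_kernelOp_dyadicKernel (ha : IsHolderSymbol τ m a) {s : ℝ}
    {W : ℕ → Rn n → ℝ≥0∞} {W' : ℕ × ℕ → Rn n → ℝ≥0∞}
    (hk : IsDominatedFamily (dyadicKernel a) W)
    (hk' : IsDominatedFamily (fun i : ℕ × ℕ => composedKernel a s i.1 i.2) W')
    (u : 𝓢(Rn n, ℂ)) {q : ℝ≥0∞} [Fact (1 ≤ q)] (hq' : q ≠ ⊤) :
    TemperedDistribution.besselPotential (Rn n) ℂ s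
      ((hk.memLp_kernelOp u Fact.out hq').toLp (kernelOp (dyadicKernel a) u) :
        Lp ℂ q (volume : Measure (Rn n)))
      = ((hk'.memLp_kernelOp u Fact.out hq').toLp _ : Lp ℂ q (volume : Measure (Rn n))) := by
  ext φ
  rw [TemperedDistribution.besselPotential, TemperedDistribution.fourierMultiplierCLM_apply_apply,
    Lp.toTemperedDistribution_apply, Lp.toTemperedDistribution_apply]
  have h := integral_mul_kernelOp_composedKernel ha hk hk' u φ
  calc _ = _ := ?_
    _ = _ := h.symm
    _ = _ := ?_
  · refine integral_congr_ae ?_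
    filter_upwards [(hk.memLp_kernelOp u Fact.out hq').coeFn_toLp] with x hx
    rw [hx, smul_eq_mul]
  · refine integral_congr_ae ?_
    filter_upwards [(hk'.memLp_kernelOp u Fact.out hq').coeFn_toLp] with x hx
    rw [hx, smul_eq_mul]

end

/-! ### The oscillatory integral -/

/-- The integrand of the regularized oscillatory integral. -/
noncomputable def regIntegrand {n : ℕ} (a : Rn n × Rn n → Rn n → ℂ) (χ : 𝓢(Rn n × Rn n, ℂ))
    (u : 𝓢(Rn n, ℂ)) (x : Rn n) (ε : ℝ) (z : Rn n × Rn n) : ℂ :=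
  χ (ε • z.1, ε • z.2) * Complex.exp (Complex.I * ((inner ℝ (x - z.1) z.2 : ℝ) : ℂ))
    * a (x, z.1) z.2 * u z.1

theorem SchwartzMap.integrable_norm_mul_bracket {n : ℕ} (χ : 𝓢(Rn n × Rn n, ℂ)) (m : ℝ) :
    Integrable (fun z : Rn n × Rn n => ‖χ z‖ * (1 + ‖z.2‖ ^ 2) ^ (m / 2)) := by
  obtain ⟨M, hM⟩ := exists_nat_ge (m / 2)
  have : (volume : Measure (Rn n × Rn n)).IsAddHaarMeasure :=
    inferInstanceAs ((volume : Measure (Rn n)).prod (volume : Measure (Rn n))).IsAddHaarMeasure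
  have h := (((χ.integrable_pow_mul volume 0).add
    (χ.integrable_pow_mul volume (2 * M))).const_mul (2 ^ (M - 1)))
  refine h.mono' ?_ (Eventually.of_forall fun z => ?_)
  · refine (χ.continuous.norm.mul ?_).aestronglyMeasurable
    exact Continuous.rpow_const (by fun_prop) fun ξ => Or.inl (by positivity)
  · rw [Real.norm_of_nonneg (by positivity)]
    have h1 : (1 + ‖z.2‖ ^ 2) ^ (m / 2) ≤ (2 : ℝ) ^ (M - 1) * (1 + ‖z‖ ^ (2 * M)) := by
      calc (1 + ‖z.2‖ ^ 2) ^ (m / 2) ≤ (1 + ‖z.2‖ ^ 2) ^ (M : ℝ) :=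
            Real.rpow_le_rpow_of_exponent_le (by nlinarith [norm_nonneg z.2]) hM
        _ = (1 + ‖z.2‖ ^ 2) ^ M := Real.rpow_natCast _ _
        _ ≤ (1 + ‖z‖ ^ 2) ^ M := by gcongr; exact norm_snd_le z
        _ ≤ 2 ^ (M - 1) * (1 ^ M + (‖z‖ ^ 2) ^ M) := add_pow_le zero_le_one (by positivity) M
        _ = _ := by rw [one_pow, pow_mul]
    calc ‖χ z‖ * (1 + ‖z.2‖ ^ 2) ^ (m / 2)
        ≤ ‖χ z‖ * (2 ^ (M - 1) * (1 + ‖z‖ ^ (2 * M))) := by gcongr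
      _ = _ := by simp only [Pi.add_apply, pow_zero]; ring

section

variable {n : ℕ} {τ m : ℝ} {a : Rn n × Rn n → Rn n → ℂ}

theorem continuous_regIntegrand (ha : IsHolderSymbol τ m a) (χ : 𝓢(Rn n × Rn n, ℂ))
    (u : 𝓢(Rn n, ℂ)) (x : Rn n) (ε : ℝ) : Continuous (regIntegrand a χ u x ε) := by
  unfold regIntegrand
  have h1 : Continuous (fun z : Rn n × Rn n => a (x, z.1) z.2) :=
    ha.continuous.comp (by fun_prop :
      Continuous fun z : Rn n × Rn n => (((x, z.1) : Rn n × Rn n), z.2))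
  have h2 : Continuous (fun z : Rn n × Rn n => χ (ε • z.1, ε • z.2)) :=
    χ.continuous.comp (by fun_prop)
  exact ((h2.mul (by fun_prop)).mul h1).mul (u.continuous.comp continuous_fst)

theorem integrable_regIntegrand (ha : IsHolderSymbol τ m a) (χ : 𝓢(Rn n × Rn n, ℂ))
    (u : 𝓢(Rn n, ℂ)) (x : Rn n) {ε : ℝ} (hε : 0 < ε) :
    Integrable (regIntegrand a χ u x ε) := by
  obtain ⟨C, hC⟩ := ha.exists_symbolBound
  set χ' : 𝓢(Rn n × Rn n, ℂ) := SchwartzMap.compCLMOfContinuousLinearEquiv ℂ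
    (ContinuousLinearEquiv.smulLeft (Units.mk0 ε hε.ne')) χ
  refine ((χ'.integrable_norm_mul_bracket m).mul_const
    (C 0 * SchwartzMap.seminorm ℝ 0 0 u)).mono'
    (continuous_regIntegrand ha χ u x ε).aestronglyMeasurable (Eventually.of_forall fun z => ?_)
  have e : χ' z = χ (ε • z.1, ε • z.2) := rfl
  rw [regIntegrand, norm_mul, norm_mul, norm_mul, norm_cexp_I_mul_ofReal, mul_one, e]
  calc _ ≤ ‖χ (ε • z.1, ε • z.2)‖ * (C 0 * (1 + ‖z.2‖ ^ 2) ^ (m / 2)) *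
        SchwartzMap.seminorm ℝ 0 0 u := by
        have h1 := (hC (x, z.1)).norm_le z.2
        have h2 := u.norm_le_seminorm ℝ z.1
        have h3 := (norm_nonneg _).trans h1
        gcongr
    _ = _ := by ring

theorem integral_dyadic_mul_regIntegrand (ha : IsHolderSymbol τ m a) (χ : 𝓢(Rn n × Rn n, ℂ))
    (u : 𝓢(Rn n, ℂ)) (x : Rn n) {ε : ℝ} (hε : 0 < ε) (j : ℕ) :
    ∫ z : Rn n × Rn n, dyadic n j z.2 * regIntegrand a χ u x ε z
      = ∫ y, 𝓕 (fun ξ => dyadic n j ξ * (χ (ε • y, ε • ξ) * a (x, y) ξ))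
          ((2 * Real.pi)⁻¹ • (y - x)) * u y := by
  have h : Integrable (fun z : Rn n × Rn n => dyadic n j z.2 * regIntegrand a χ u x ε z) :=
    integrable_dyadic_mul measurable_snd (integrable_regIntegrand ha χ u x hε) j
  rw [Measure.volume_eq_prod] at h ⊢
  rw [integral_prod _ h]
  congr 1 with y
  rw [fourier_two_pi_inv_smul, ← integral_mul_const]
  congr 1 with ξ
  simp only [regIntegrand]
  ring

/-- The product `χ(εy, εξ) a(x, y, ξ)` is a symbol of the same order with constants independent of
`ε`, `x`, `y`, and it is as small near the diagonal as `a`. The kernel estimate therefore applies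
uniformly. -/
theorem exists_norm_integral_dyadic_mul_regIntegrand_le {τ' : ℝ} (hτ' : 0 < τ') (hττ' : τ' < τ)
    (ha : IsHolderSymbol τ m a)
    (hdiag : ∀ x ξ : Rn n, ∀ j : ℕ, (j : ℝ) < τ →
      iteratedFDeriv ℝ j (fun X : Rn n × Rn n => a X ξ) (x, x) = 0)
    (χ : 𝓢(Rn n × Rn n, ℂ)) (u : 𝓢(Rn n, ℂ)) :
    ∃ K : ℝ, ∀ (x : Rn n) (ε : ℝ) (j : ℕ), 0 < ε → ε ≤ 1 →
      ‖∫ z : Rn n × Rn n, dyadic n j z.2 * regIntegrand a χ u x ε z‖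
        ≤ K * ((2 : ℝ) ^ j) ^ (m - τ') := by
  obtain ⟨A, hA, hle⟩ := ha.exists_norm_le_of_diag (hτ'.trans hττ') hdiag
  obtain ⟨C, hC⟩ := ha.exists_symbolBound
  obtain ⟨D, hD⟩ := SchwartzMap.exists_symbolBound_dilate (n := n) χ
  set B := SchwartzMap.seminorm ℝ 0 0 χ
  have hB : 0 ≤ B := apply_nonneg _ _
  obtain ⟨K, hK, h⟩ := exists_norm_fourier_dyadic_le_dyadicWeight n (0 + m)
    (fun i => ∑ k ∈ Finset.range (i + 1), (i.choose k : ℝ) * D k * C (i - k)) (B * A)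
    (by positivity) hτ' hττ'
  set U := SchwartzMap.seminorm ℝ 0 0 u
  refine ⟨K * (∫ z : Rn n, ((1 + ‖z‖) ^ (n + 1))⁻¹) * U, fun x ε j hε hε' => ?_⟩
  rw [integral_dyadic_mul_regIntegrand ha χ u x hε j]
  have hp (y : Rn n) : ‖𝓕 (fun ξ => dyadic n j ξ * (χ (ε • y, ε • ξ) * a (x, y) ξ))
      ((2 * Real.pi)⁻¹ • (y - x))‖
      ≤ K * ((2 : ℝ) ^ j) ^ (m - τ') * dyadicWeight n j (y - x) := by
    -- For frozen `y` the cutoff is a dilate along the `ξ`-axis through `(ε • y, 0)`; in the product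
    -- norm its argument has size at least `ε ‖ξ‖`.
    have h1 := hD (ε • y, 0) ε (ContinuousLinearMap.inr ℝ (Rn n) (Rn n)) hε.le hε'
      (ContinuousLinearMap.opNorm_le_bound _ zero_le_one fun ξ => by simp [Prod.norm_def])
      (fun ξ => by
        refine le_trans ?_ (norm_snd_le _)
        simp [norm_smul, abs_of_pos hε])
    have e : (fun ξ : Rn n => χ (((ε • y, 0) : Rn n × Rn n)
        + ε • ContinuousLinearMap.inr ℝ (Rn n) (Rn n) ξ)) = fun ξ => χ (ε • y, ε • ξ) := by
      ext ξ; simp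
    rw [e] at h1
    have h2 := h _ (y - x) (h1.mul (hC (x, y))) (fun ξ => ?_) j
    · rwa [zero_add] at h2
    · rw [norm_mul, zero_add, mul_assoc B, mul_assoc B]
      gcongr
      · exact χ.norm_le_seminorm ℝ _
      · exact hle x y ξ
  have hInt : Integrable (fun y => K * ((2 : ℝ) ^ j) ^ (m - τ') * dyadicWeight n j (y - x) * U) :=
    (((integrable_dyadicWeight n j).comp_sub_right x).const_mul _).mul_const _
  refine (norm_integral_le_of_norm_le hInt (Eventually.of_forall fun y => ?_)).trans_eq ?_
  · rw [norm_mul]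
    have h3 := hp y
    have h4 := (norm_nonneg _).trans h3
    gcongr
    exact u.norm_le_seminorm ℝ y
  · rw [integral_mul_const, integral_const_mul,
      integral_sub_right_eq_self (fun z => dyadicWeight n j z) x, integral_dyadicWeight]
    ring

/-- On one shell the integrand without cutoff is already integrable: `ξ` is confined to a compact
set and `u` gives integrability in `y`. The cutoff is bounded and tends to `χ (0, 0) = 1`. -/
theorem tendsto_integral_dyadic_mul_regIntegrand (ha : IsHolderSymbol τ m a)
    (χ : 𝓢(Rn n × Rn n, ℂ)) (hχ : χ (0, 0) = 1) (u : 𝓢(Rn n, ℂ)) (x : Rn n) (j : ℕ) :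
    Tendsto (fun ε => ((2 * (Real.pi : ℂ)) ^ n)⁻¹ *
      ∫ z : Rn n × Rn n, dyadic n j z.2 * regIntegrand a χ u x ε z) (𝓝[>] 0)
      (𝓝 (∫ y, dyadicKernel a j x y * u y)) := by
  obtain ⟨C, hC⟩ := ha.exists_symbolBound
  set B := SchwartzMap.seminorm ℝ 0 0 χ
  have hB : 0 ≤ B := apply_nonneg _ _
  set G : Rn n × Rn n → ℂ := fun z =>
    Complex.exp (Complex.I * ((inner ℝ (x - z.1) z.2 : ℝ) : ℂ)) *
      (dyadic n j z.2 * a (x, z.1) z.2) * u z.1 with hG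
  have hle (z : Rn n × Rn n) : ‖G z‖ ≤
      ‖u z.1‖ * (‖dyadic n j z.2‖ * (C 0 * (1 + ‖z.2‖ ^ 2) ^ (m / 2))) := by
    rw [hG]
    simp only [norm_mul, norm_cexp_I_mul_ofReal, one_mul]
    rw [mul_comm]
    gcongr
    exact (hC _).norm_le _
  have hdom : Integrable (fun z : Rn n × Rn n =>
      ‖u z.1‖ * (‖dyadic n j z.2‖ * (C 0 * (1 + ‖z.2‖ ^ 2) ^ (m / 2)))) :=
    u.integrable.norm.mul_prod (integrable_dyadic_mul_bracket n j m (C 0))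
  have hGc : Continuous G := by
    have h1 : Continuous (fun z : Rn n × Rn n => a (x, z.1) z.2) :=
      ha.continuous.comp (by fun_prop :
        Continuous fun z : Rn n × Rn n => (((x, z.1) : Rn n × Rn n), z.2))
    exact (Continuous.mul (by fun_prop) (((continuous_dyadic n j).comp continuous_snd).mul h1)).mul
      (u.continuous.comp continuous_fst)
  have hGi : Integrable G := hdom.mono' hGc.aestronglyMeasurable (Eventually.of_forall hle)
  have e1 : ∫ y, dyadicKernel a j x y * u y = ((2 * (Real.pi : ℂ)) ^ n)⁻¹ * ∫ z, G z := by
    rw [Measure.volume_eq_prod] at hGi ⊢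
    rw [integral_prod _ hGi, ← integral_const_mul]
    congr 1 with y
    rw [dyadicKernel_eq_integral, mul_assoc, ← integral_mul_const]
  rw [e1]
  refine Tendsto.const_mul _ ?_
  have e2 (ε : ℝ) (z : Rn n × Rn n) : dyadic n j z.2 * regIntegrand a χ u x ε z
      = χ (ε • z.1, ε • z.2) * G z := by
    simp only [regIntegrand, hG]; ring
  simp_rw [e2]
  refine tendsto_integral_filter_of_dominated_convergence (fun z => B * ‖G z‖)
    (Eventually.of_forall fun ε => ?_) (Eventually.of_forall fun ε => Eventually.of_forall
      fun z => ?_) (hGi.norm.const_mul B) (Eventually.of_forall fun z => ?_)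
  · have h2 : Continuous (fun z : Rn n × Rn n => χ (ε • z.1, ε • z.2)) :=
      χ.continuous.comp (by fun_prop)
    exact (h2.mul hGc).aestronglyMeasurable
  · rw [norm_mul]
    gcongr
    exact χ.norm_le_seminorm ℝ _
  · have h2 : Continuous (fun ε : ℝ => χ (ε • z.1, ε • z.2)) := χ.continuous.comp (by fun_prop)
    have h3 := (h2.tendsto 0).mono_left (nhdsWithin_le_nhds (s := Set.Ioi 0))
    simp only [zero_smul, hχ] at h3
    simpa using h3.mul_const (G z)

/-- The oscillatory integral is the sum of the dyadic integral operators. -/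
theorem hasOscIntegral_kernelOp_dyadicKernel {τ' : ℝ} (hτ' : 0 < τ') (hττ' : τ' < τ) (hm : m < τ')
    (ha : IsHolderSymbol τ m a)
    (hdiag : ∀ x ξ : Rn n, ∀ j : ℕ, (j : ℝ) < τ →
      iteratedFDeriv ℝ j (fun X : Rn n × Rn n => a X ξ) (x, x) = 0)
    (u : 𝓢(Rn n, ℂ)) (x : Rn n) :
    HasOscIntegral a u x (kernelOp (dyadicKernel a) u x) := by
  intro χ hχ
  obtain ⟨K, hK⟩ := exists_norm_integral_dyadic_mul_regIntegrand_le hτ' hττ' ha hdiag χ u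
  set T : ℝ → ℕ → ℂ := fun ε j => ((2 * (Real.pi : ℂ)) ^ n)⁻¹ *
      ∫ z : Rn n × Rn n, dyadic n j z.2 * regIntegrand a χ u x ε z with hT
  have hsum : Summable (fun j : ℕ => K * ((2 : ℝ) ^ j) ^ (m - τ')) :=
    (summable_two_pow_rpow (by linarith)).mul_left K
  have hbound (ε : ℝ) (hε : 0 < ε) (hε' : ε ≤ 1) (j : ℕ) :
      ‖T ε j‖ ≤ K * ((2 : ℝ) ^ j) ^ (m - τ') := by
    rw [hT, norm_mul]
    exact (mul_le_of_le_one_left (norm_nonneg _) (norm_two_pi_pow_inv_le_one n)).trans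
      (hK x ε j hε hε')
  have hev : ∀ᶠ ε : ℝ in 𝓝[>] 0, 0 < ε ∧ ε ≤ 1 := Ioc_mem_nhdsGT zero_lt_one
  -- The limit is taken term by term under a summable bound uniform in `ε`. For each `ε > 0` the sum
  -- over `j` is the regularized integral itself, by integrability of its integrand.
  refine (tendsto_tsum_of_dominated_convergence hsum
    (fun j => tendsto_integral_dyadic_mul_regIntegrand ha χ hχ u x j)
    (hev.mono fun ε hε => hbound ε hε.1 hε.2)).congr' (hev.mono fun ε hε => ?_)
  have h1 := (Summable.of_norm_bounded hsum (hbound ε hε.1 hε.2)).hasSum.tendsto_sum_nat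
  refine tendsto_nhds_unique h1 ?_
  simp_rw [hT, ← Finset.mul_sum]
  exact (tendsto_sum_integral_dyadic_mul measurable_snd
    (integrable_regIntegrand ha χ u x hε.1)).const_mul _

end

/-! ### Choice of `τ'`, extension by density and conclusion. -/

theorem theorem3p6 (n : ℕ) (hn : 1 ≤ n) (τ m : ℝ) (hτ : 0 < τ) (hm : m < τ)
    (a : Rn n × Rn n → Rn n → ℂ) (ha : IsHolderSymbol τ m a)
    -- all `∂_x^α ∂_y^β a` with `|α| + |β| = j < τ` vanish on the diagonal `y = x`
    (hdiag : ∀ x ξ : Rn n, ∀ j : ℕ, (j : ℝ) < τ →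
      iteratedFDeriv ℝ j (fun X : Rn n × Rn n => a X ξ) (x, x) = 0)
    (q : ℝ≥0∞) [Fact (1 ≤ q)] (hq : 1 < q) (hq' : q < ⊤)
    (s : ℝ) (hs : 0 ≤ s) (hs' : s < min (τ - m) τ) :
    ∃ T : Lp ℂ q (volume : Measure (Rn n)) →ₗ[ℂ] 𝓢'(Rn n, ℂ),
      (∃ C : ℝ, ∀ f, HasSobolevBound s q (C * ‖f‖) (T f)) ∧
      ∀ u : 𝓢(Rn n, ℂ), ∃ v : Rn n → ℂ, (∀ x, HasOscIntegral a u x (v x)) ∧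
        ∃ hv : MemLp v q volume, T (u.toLp q) = (hv.toLp v : Lp ℂ q (volume : Measure (Rn n))) := by
  obtain ⟨hs1, hs2⟩ := lt_min_iff.1 hs'
  have hm0 : 0 ≤ max m 0 := le_max_right _ _
  -- The two bounds in the minimum correspond to `m ≥ 0` and `m < 0`. Regarding `a` as a symbol of
  -- order `max m 0` treats both at once.
  have hsm : s + max m 0 < τ := by
    rcases max_cases m 0 with h | h <;> linarith
  obtain ⟨τ', hτ'1, hτ'2⟩ := exists_between hsm
  replace ha := ha.mono (le_max_left m 0)
  have hτ'0 : 0 < τ' := by linarith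
  have hm' : max m 0 < τ' := by linarith
  obtain ⟨K, -, hk⟩ := exists_isDominatedFamily_dyadicKernel hτ'0 hτ'2 hm' ha hdiag
  obtain ⟨K₁, K₂, hk'⟩ := exists_isDominatedFamily_composedKernel hs hm0 hτ'1 hτ'2 ha hdiag
  obtain ⟨S₁, hS₁⟩ := hk.exists_clm q hq'.ne
  obtain ⟨S₂, hS₂⟩ := hk'.exists_clm q hq'.ne
  have hd : DenseRange (SchwartzMap.toLpCLM ℂ ℂ q (volume : Measure (Rn n))) :=
    SchwartzMap.denseRange_toLpCLM (F := ℂ) hq'.ne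
  set J := Lp.toTemperedDistributionCLM ℂ (volume : Measure (Rn n)) q
  have hbessel (f : Lp ℂ q (volume : Measure (Rn n))) :
      TemperedDistribution.besselPotential (Rn n) ℂ s (J (S₁ f)) = J (S₂ f) := by
    -- Both sides are continuous from `L_q` to tempered distributions and agree on Schwartz
    -- functions. Hence `S₂ f` represents the Bessel potential of `S₁ f` for every `f`, and `‖S₂‖`
    -- serves as the Sobolev constant.
    refine congrFun (hd.equalizer
      (g := fun f => TemperedDistribution.besselPotential (Rn n) ℂ s (J (S₁ f)))
      (h := fun f => J (S₂ f)) (by fun_prop) (by fun_prop) (funext fun u => ?_)) f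
    simp only [Function.comp_apply, SchwartzMap.toLpCLM_apply, hS₁, hS₂]
    exact besselPotential_kernelOp_dyadicKernel ha hk hk' u hq'.ne
  refine ⟨(J ∘L S₁).toLinearMap, ⟨‖S₂‖, fun f => ⟨S₂ f, hbessel f, S₂.le_opNorm f⟩⟩, fun u =>
    ⟨kernelOp (dyadicKernel a) u, fun x =>
      hasOscIntegral_kernelOp_dyadicKernel hτ'0 hτ'2 hm' ha hdiag u x,
      hk.memLp_kernelOp u Fact.out hq'.ne, ?_⟩⟩
  rw [← hS₁ u]
  rfl
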